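/- Let $a_n\ge 1$ be integers with $a_n\to\infty$, let $b_n>0$, and for each $n\ge1$ let $\xi_{1,n},\dots,\xi_{a_n,n}$ be i.i.d. real random variables; put $X_{k,n}=\xi_{k,n}/b_n$ and $S_n=X_{1,n}+\dots+X_{a_n,n}$. Let $\theta_n$ be the characteristic function of $\xi_{1,n}$, $F_n$ the law of $X_{1,n}$, $M_n(du)=a_nu^2F_n(du)$ and $\beta_n=\int\sin u\,F_n(du)$. A measure $M$ on $\mathbb R$ is canonical if it is finite on bounded intervals and $M^+(x)=\int_{[x,\infty)}u^{-2}M(du)<\infty$, $M^-(x)=\int_{(-\infty,-x]}u^{-2}M(du)<\infty$ for all $x>0$. Write $M_n\to M$ (properly) if $M_n(I)\to M(I)$ for every bounded interval $I$ whose end points are not atoms of $M$, and, for $x>0$, $M_n^{+}(x)\to M^{+}(x)$ if $x$ is not an atom of $M$ and $M_n^-(x)\to M^-(x)$ if $-x$ is not an atom of $M$. Write $\hat m(A)=\frac12(m(A)+m(-A))$ for the symmetrization of a measure $m$. Assume $P(|X_{1,n}|\ge\varepsilon)\to0$ for every $\varepsilon>0$, and $M_n\to M$, $a_n\beta_n\to\beta$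 for some canonical measure $M$ and some $\beta\in\mathbb R$. Put $$\phi(z)=\int_{\mathbb R}\frac{1-e^{izu}+iz\sin u}{u^2}M(du),\quad \phi_n(z)=\int_{\mathbb R}\frac{1-e^{izu}+iz\sin u}{u^2}M_n(du),\quad \psi(z)=-i\beta z+\phi(z)$$ (the integrand at $u=0$ being $z^2/2$). Assume that: A. for every $n\ge1$ the variable $\xi_{1,n}$ has a density $g_n$; B. there are $\alpha\in(0,2)$ and $c>0$ with $\operatorname{Re}\psi(z)\ge c|z|^\alpha$ for $|z|$ large enough; C. $N(\delta'):=\sup_{n\ge1,\,|z|\ge\delta'}|\theta_n(z)|<1$ for every $\delta'>0$; D. $\sup_{n\ge1}\int g_n^2(x)\,dx<\infty$; E. $b_n\to\infty$ and $\frac{\ln b_n}{a_n}\to0$; and that for some fixed $\delta>0$: F. there are $c(\delta)>0$ and $\kappa\in(0,2)$ such that for each $n\ge1$ one of the following holds: (a) $a_n\int(1-\cos(zu))\hat F_n(du)\ge c(\delta)|z|^\kappa$ for all $|z|\le\delta b_n$; (b) $\hat M\le\hat M_n$; G. $\inf_{n\ge1,\,|z|\le\delta}|\operatorname{Re}\theta_n(z)|>0$.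 Then $S_n$ converges in distribution to an infinitely divisible random variable $S$ with characteristic function $e^{-\psi}$; the laws of $S_n$ and $S$ have densities $p_n$ and $p$, where $p$, and $p_n$ for all large $n$, are taken continuous; and for every $\epsilon\in(0,1)$ there is a constant $C$, not depending on $n$, such that for all sufficiently large $n$ $$\sup_{x\in\mathbb R}|p_n(x)-p(x)|\le C\max\Big(\chi_n,\gamma_n',\gamma_n'',\tfrac1{a_n},e^{a_n(\ln N(\delta)+\epsilon)}e^{-(1-\epsilon)\operatorname{Re}\psi(\delta b_n)}\Big),$$ where $\chi_n=|a_n\beta_n-\beta|$, $\gamma_n'=\sup_{z\in\mathbb R}\frac{|\operatorname{Re}\phi(z)-\operatorname{Re}\phi_n(z)|}{1+z^2}$ and $\gamma_n''=\sup_{z\in\mathbb R}\frac{|\operatorname{Im}\phi(z)-\operatorname{Im}\phi_n(z)|}{1+z^2}$. -/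

import Mathlib

open MeasureTheory ProbabilityTheory Filter Topology

noncomputable section

namespace TriangularArray

/-! ### Measures on the line -/

/-- The symmetrization `m̂(A) = (m(A) + m(-A)) / 2` of a measure on `ℝ`. -/
def symm (m : Measure ℝ) : Measure ℝ :=
  (2⁻¹ : ENNReal) • (m + m.map (fun u : ℝ => -u))

/-- `M⁺(x) = ∫_{[x, ∞)} u⁻² M(du)`. -/
def tailPos (M : Measure ℝ) (x : ℝ) : ENNReal :=
  ∫⁻ u in Set.Ici x, ENNReal.ofReal (1 / u ^ 2) ∂M

/-- `M⁻(x) = ∫_{(-∞, -x]} u⁻² M(du)`. -/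
def tailNeg (M : Measure ℝ) (x : ℝ) : ENNReal :=
  ∫⁻ u in Set.Iic (-x), ENNReal.ofReal (1 / u ^ 2) ∂M

/-- Canonical measures: finite on bounded intervals, with finite tails `M⁺(x)`, `M⁻(x)`, `x > 0`. -/
structure IsCanonical (M : Measure ℝ) : Prop where
  finite_interval : ∀ s t : ℝ, M (Set.Icc s t) < ⊤
  finite_tailPos : ∀ x : ℝ, 0 < x → tailPos M x < ⊤
  finite_tailNeg : ∀ x : ℝ, 0 < x → tailNeg M x < ⊤

/-- Proper convergence `Mₙ → M` of canonical measures. As usual for weak-type convergence, the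
intervals are intervals of continuity of the limit: their end points are not atoms of `M`. -/
structure ConvergesProperly (Mn : ℕ → Measure ℝ) (M : Measure ℝ) : Prop where
  interval : ∀ s t : ℝ, s < t → M {s} = 0 → M {t} = 0 →
    Tendsto (fun n => Mn n (Set.Icc s t)) atTop (𝓝 (M (Set.Icc s t)))
  tail_pos : ∀ x : ℝ, 0 < x → M {x} = 0 →
    Tendsto (fun n => tailPos (Mn n) x) atTop (𝓝 (tailPos M x))
  tail_neg : ∀ x : ℝ, 0 < x → M {-x} = 0 →
    Tendsto (fun n => tailNeg (Mn n) x) atTop (𝓝 (tailNeg M x))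

/-- The nonnegative measurable function `f` is a density of the measure `m` on `ℝ` with respect to
Lebesgue measure. -/
structure IsDensity (m : Measure ℝ) (f : ℝ → ℝ) : Prop where
  measurable : Measurable f
  nonneg : ∀ x, 0 ≤ f x
  eq_withDensity : m = volume.withDensity (fun x => ENNReal.ofReal (f x))

/-- `P` is infinitely divisible: for every `k ≥ 1` it is the law of a sum of `k` i.i.d. variables. -/
def IsInfinitelyDivisible (P : Measure ℝ) : Prop :=
  ∀ k : ℕ, 0 < k → ∃ ν : Measure ℝ, IsProbabilityMeasure ν ∧
    (Measure.pi (fun _ : Fin k => ν)).map (fun x => ∑ i, x i) = P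

/-! ### The Lévy–Khintchine exponent -/

/-- The function `u ↦ (1 - e^{izu} + i z sin u) / u²`, extended by continuity to `u = 0`, where its
value is `z² / 2`. -/
def levyKernel (z u : ℝ) : ℂ :=
  if u = 0 then (z : ℂ) ^ 2 / 2
  else (1 - Complex.exp (Complex.I * z * u) + Complex.I * z * Real.sin u) / (u : ℂ) ^ 2

/-- `φ(z) = ∫ (1 - e^{izu} + i z sin u) u⁻² M(du)`. -/
def phi (M : Measure ℝ) (z : ℝ) : ℂ := ∫ u, levyKernel z u ∂M

/-- The characteristic exponent `ψ(z) = -iβz + φ(z)`. -/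
def psi (β : ℝ) (M : Measure ℝ) (z : ℝ) : ℂ := -Complex.I * β * z + phi M z

/-! ### The array

`G n` is the common law of the variables `ξ_{k,n}` in the `n`-th row, `a n` the length of the row and
`b n` the norming constant. -/

/-- The law `Fₙ` of `X_{1,n} = ξ_{1,n} / bₙ`. -/
def lawX (G : ℕ → Measure ℝ) (b : ℕ → ℝ) (n : ℕ) : Measure ℝ := (G n).map (fun x => x / b n)

/-- `Mₙ(du) = aₙ u² Fₙ(du)`. -/
def canon (G : ℕ → Measure ℝ) (a : ℕ → ℕ) (b : ℕ → ℝ) (n : ℕ) : Measure ℝ :=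
  (lawX G b n).withDensity (fun u => ENNReal.ofReal (a n * u ^ 2))

/-- `βₙ = ∫ sin u Fₙ(du)`. -/
def betaN (G : ℕ → Measure ℝ) (b : ℕ → ℝ) (n : ℕ) : ℝ := ∫ u, Real.sin u ∂(lawX G b n)

/-- `N(δ) = sup_{n, |z| ≥ δ} |θₙ(z)|`, where `θₙ` is the characteristic function of `ξ_{1,n}`. -/
def supN (G : ℕ → Measure ℝ) (δ : ℝ) : ℝ :=
  sSup {r : ℝ | ∃ (n : ℕ) (z : ℝ), δ ≤ |z| ∧ r = ‖charFun (G n) z‖}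

/-- `sup_z |Re φ(z) - Re φ'(z)| / (1 + z²)` for the functions `φ`, `φ'` of `M`, `M'`; the quotient is
bounded whenever `M` and `M'` are canonical. -/
def gammaRe (M M' : Measure ℝ) : ℝ := ⨆ z : ℝ, |(phi M z).re - (phi M' z).re| / (1 + z ^ 2)

/-- `sup_z |Im φ(z) - Im φ'(z)| / (1 + z²)` for the functions `φ`, `φ'` of `M`, `M'`; the quotient is
bounded whenever `M` and `M'` are canonical. -/
def gammaIm (M M' : Measure ℝ) : ℝ := ⨆ z : ℝ, |(phi M z).im - (phi M' z).im| / (1 + z ^ 2)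

/-- `χₙ = |aₙ βₙ - β|`. -/
def chi (G : ℕ → Measure ℝ) (a : ℕ → ℕ) (b : ℕ → ℝ) (β : ℝ) (n : ℕ) : ℝ :=
  |(a n : ℝ) * betaN G b n - β|

/-- The rate `ρ_{ε,δ}(n)`. -/
def rho (G : ℕ → Measure ℝ) (a : ℕ → ℕ) (b : ℕ → ℝ) (β : ℝ) (M : Measure ℝ) (ε δ : ℝ) (n : ℕ) : ℝ :=
  max (chi G a b β n)
    (max (gammaRe M (canon G a b n))
      (max (gammaIm M (canon G a b n))
        (max (1 / (a n : ℝ))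
          (Real.exp (a n * (Real.log (supN G δ) + ε)) *
            Real.exp (-(1 - ε) * (psi β M (δ * b n)).re)))))

/-- The normalized row sum `Sₙ = (ξ_{1,n} + … + ξ_{aₙ,n}) / bₙ`. -/
def rowSum {Ω : ℕ → Type*} {a : ℕ → ℕ} (ξ : (n : ℕ) → Fin (a n) → Ω n → ℝ) (b : ℕ → ℝ)
    (n : ℕ) (ω : Ω n) : ℝ :=
  (∑ k, ξ n k ω) / b n

end TriangularArray

end

open TriangularArray

noncomputable section

namespace TriangularArray

/-! ### The Lévy–Khintchine kernel -/

/-! Write `f_n(z) = θ_n(z / b_n)` for the characteristic function of `X_{1,n}`. The factor `u²` in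
`M_n` cancels the denominator of the Lévy kernel, and the drift `a_n β_n` cancels its sine term, so
`a_n (1 - f_n)` is exactly the exponent `ψ_n` built from `M_n` and `a_n β_n`
(`mul_one_sub_charFun_lawX`). Proper convergence gives `ψ_n → ψ` pointwise
(`tendsto_phi_of_convergesProperly`), hence `f_n ^ a_n = (1 - ψ_n / a_n) ^ a_n → e^{-ψ}`. Lévy's
continuity theorem gives the limit law, and sums of `⌊a_n / k⌋` terms give its `k`-th convolution
roots.

By Fourier inversion the uniform distance of the densities is at most the `L¹` distance of `f_n ^
a_n` and `e^{-ψ}`. This integral is split at `|z| = δ b_n`.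

For `|z| ≤ δ b_n`, telescoping the power gives a bound `R ^ (a_n - 1) (|ψ_n - ψ| + 3 |ψ|² / a_n)`.
The bracket is `O(ρ_n (1 + z²)²)`, where `ρ_n` is the rate; the power must supply a decay `(1 +
z²)⁻³`. Conditions B and F give such a decay for `e^{-ψ}` and for `exp (-s Re ψ_n)`, but the latter
sees only `Re θ_n`, whereas the power needs `|θ_n|`. The bridge is `mul_one_sub_re_charFun_le`:
under C and G, `1 - |θ_n|` is at least a constant times `1 - Re θ_n`.

For `|z| > δ b_n`, two factors `|f_n|` are set aside; their integral is `O(b_n)` by D and a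
Plancherel inequality (`lintegral_norm_charFun_sq_le`). The other factors are at most some `q < 1`,
and `b_n q ^ a_n = O(1 / a_n)` by E. The tail of `e^{-ψ}` is `O(1 / a_n)` as well, because `a_n =
O(b_n²)` (`exists_eventually_natCast_le_mul_sq`). So the first four terms of the rate already
suffice. -/

/-- The half-plane makes the quadratic Taylor bound global: beyond the unit disc `|e^w| ≤ 1` and the
triangle inequality are enough. -/
lemma norm_exp_sub_one_sub_id_le_of_re_nonpos {w : ℂ} (hw : w.re ≤ 0) :
    ‖Complex.exp w - 1 - w‖ ≤ 3 * ‖w‖ ^ 2 := by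
  rcases le_or_gt ‖w‖ 1 with h | h
  · have := Complex.norm_exp_sub_one_sub_id_le h
    nlinarith [sq_nonneg ‖w‖]
  · have h1 : ‖Complex.exp w‖ ≤ 1 := by
      rw [Complex.norm_exp]; exact Real.exp_le_one_iff.2 hw
    calc ‖Complex.exp w - 1 - w‖ ≤ ‖Complex.exp w‖ + ‖(1 : ℂ)‖ + ‖w‖ :=
          (norm_sub_le _ _).trans (by gcongr; exact norm_sub_le _ _)
      _ ≤ 3 * ‖w‖ ^ 2 := by rw [norm_one]; nlinarith

lemma abs_sin_sub_self_le {u : ℝ} (hu : |u| ≤ 1) : |Real.sin u - u| ≤ |u| ^ 3 := by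
  have h := Real.sin_bound hu
  have e : Real.sin u - u = (Real.sin u - (u - u ^ 3 / 6)) + -(u ^ 3 / 6) := by ring
  have h3 : |-(u ^ 3 / 6)| = |u| ^ 3 / 6 := by
    rw [abs_neg, abs_div, abs_pow]; norm_num
  rw [e]
  refine (abs_add_le _ _).trans ?_
  rw [h3]
  have : |u| ^ 5 ≤ |u| ^ 3 := pow_le_pow_of_le_one (abs_nonneg _) hu (by norm_num)
  have : 0 ≤ |u| ^ 3 := by positivity
  linarith

lemma levyKernel_mul_sq (z u : ℝ) : levyKernel z u * (u : ℂ) ^ 2 =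
    1 - Complex.exp (Complex.I * z * u) + Complex.I * z * Real.sin u := by
  rcases eq_or_ne u 0 with rfl | h
  · simp [levyKernel]
  · have : (u : ℂ) ≠ 0 := by exact_mod_cast h
    rw [levyKernel, if_neg h]
    field_simp

lemma norm_exp_I_mul_mul (z u : ℝ) : ‖Complex.exp (Complex.I * z * u)‖ = 1 := by
  rw [Complex.norm_exp]; simp

lemma norm_levyKernel_le_div {z u : ℝ} (hu : u ≠ 0) : ‖levyKernel z u‖ ≤ (2 + |z|) / u ^ 2 := by
  rw [levyKernel, if_neg hu, norm_div, norm_pow, Complex.norm_real, Real.norm_eq_abs, sq_abs]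
  gcongr
  calc _ ≤ ‖(1 : ℂ)‖ + ‖Complex.exp (Complex.I * z * u)‖ + ‖Complex.I * z * Real.sin u‖ :=
        (norm_add_le _ _).trans (by gcongr; exact norm_sub_le _ _)
    _ ≤ 2 + |z| := by
        rw [norm_exp_I_mul_mul, norm_mul, norm_mul, Complex.norm_I, Complex.norm_real,
          Complex.norm_real, norm_one, Real.norm_eq_abs, Real.norm_eq_abs]
        nlinarith [Real.abs_sin_le_one u, abs_nonneg z]

/-- The term `i z sin u` removes the linear part of the exponential, so the numerator is of order
`u²`. -/
lemma norm_levyKernel_le_of_abs_le_one {z u : ℝ} (hu : |u| ≤ 1) :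
    ‖levyKernel z u‖ ≤ 4 * (1 + z ^ 2) := by
  have hz : |z| ≤ 1 + z ^ 2 := by nlinarith [sq_nonneg (|z| - 1), sq_abs z, abs_nonneg z]
  rcases eq_or_ne u 0 with rfl | h
  · rw [levyKernel, if_pos rfl, norm_div, norm_pow, Complex.norm_real, Real.norm_eq_abs, sq_abs]
    simp only [Complex.norm_ofNat]
    nlinarith [sq_nonneg z]
  · rw [levyKernel, if_neg h, norm_div, norm_pow, Complex.norm_real, Real.norm_eq_abs, sq_abs,
      div_le_iff₀ (by positivity)]
    have e : (1 - Complex.exp (Complex.I * z * u) + Complex.I * z * Real.sin u : ℂ) =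
        -(Complex.exp (Complex.I * z * u) - 1 - Complex.I * z * u) +
          Complex.I * z * ((Real.sin u - u : ℝ) : ℂ) := by push_cast; ring
    have h1 := norm_exp_sub_one_sub_id_le_of_re_nonpos (w := Complex.I * z * u) (by simp)
    have h2 := abs_sin_sub_self_le hu
    rw [e]
    refine (norm_add_le _ _).trans ?_
    rw [norm_neg]
    rw [norm_mul (Complex.I * z), norm_mul Complex.I, Complex.norm_I, Complex.norm_real,
      Complex.norm_real, Real.norm_eq_abs, Real.norm_eq_abs]
    rw [norm_mul (Complex.I * z), norm_mul Complex.I, Complex.norm_I, Complex.norm_real,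
      Complex.norm_real, Real.norm_eq_abs, Real.norm_eq_abs, one_mul, mul_pow, sq_abs, sq_abs] at h1
    have h3 : |u| ^ 3 ≤ u ^ 2 := by
      rw [← sq_abs u]; exact pow_le_pow_of_le_one (abs_nonneg _) hu (by norm_num)
    have : |z| * |Real.sin u - u| ≤ (1 + z ^ 2) * u ^ 2 :=
      mul_le_mul hz (h2.trans h3) (abs_nonneg _) (by positivity)
    nlinarith [sq_nonneg u, sq_nonneg z]

/-- An integrable bound for the Lévy kernel. -/
def levyBound (u : ℝ) : ℝ := if |u| ≤ 1 then 1 else 1 / u ^ 2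

lemma levyBound_nonneg (u : ℝ) : 0 ≤ levyBound u := by
  unfold levyBound; split_ifs <;> positivity

lemma levyBound_le_one (u : ℝ) : levyBound u ≤ 1 := by
  unfold levyBound
  split_ifs with h
  · exact le_rfl
  · rw [not_le] at h
    rw [div_le_one₀ (by rw [← sq_abs]; positivity), ← sq_abs]
    nlinarith

lemma measurable_levyBound : Measurable levyBound :=
  Measurable.ite (measurableSet_le (by fun_prop) (by fun_prop)) (by fun_prop) (by fun_prop)

lemma norm_levyKernel_le (z u : ℝ) : ‖levyKernel z u‖ ≤ 4 * (1 + z ^ 2) * levyBound u := by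
  unfold levyBound
  split_ifs with h
  · simpa using norm_levyKernel_le_of_abs_le_one h
  · have hu : u ≠ 0 := by rintro rfl; simp at h
    refine (norm_levyKernel_le_div hu).trans ?_
    rw [div_eq_mul_one_div]
    gcongr
    nlinarith [sq_nonneg (|z| - 1), sq_abs z, abs_nonneg z]

lemma continuous_levyKernel_left (u : ℝ) : Continuous fun z => levyKernel z u := by
  unfold levyKernel
  split_ifs
  · fun_prop
  · fun_prop

/-- Third-order Taylor expansion: the quadratic term of the exponential is the value at `0`, and the
remainder is cubic in `u`. This yields continuity of the kernel at `0`. -/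
lemma norm_levyKernel_sub_le {z u : ℝ} (hu : |u| ≤ 1) (hzu : |z * u| ≤ 1) :
    ‖levyKernel z u - levyKernel z 0‖ ≤ (|z| ^ 3 + |z|) * |u| := by
  rcases eq_or_ne u 0 with rfl | h
  · simp
  have hu' : (u : ℂ) ≠ 0 := by exact_mod_cast h
  have e : levyKernel z u - levyKernel z 0 =
      (-(Complex.exp (Complex.I * z * u) - ∑ m ∈ Finset.range 3,
          (Complex.I * z * u) ^ m / (m.factorial : ℂ)) +
        Complex.I * z * ((Real.sin u - u : ℝ) : ℂ)) / (u : ℂ) ^ 2 := by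
    rw [levyKernel, levyKernel, if_neg h, if_pos rfl]
    simp only [Finset.sum_range_succ, Finset.range_zero, Finset.sum_empty, Nat.factorial]
    field_simp
    push_cast
    linear_combination (-2 * (z : ℂ) ^ 2 * u ^ 2) * Complex.I_sq
  have hw : ‖Complex.I * z * u‖ = |z| * |u| := by simp
  have h1 := Complex.exp_bound (x := Complex.I * z * u) (by rw [hw, ← abs_mul]; exact hzu)
    (n := 3) (by norm_num)
  rw [hw] at h1
  have h2 := abs_sin_sub_self_le hu
  rw [e, norm_div, norm_pow, Complex.norm_real, Real.norm_eq_abs,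
    div_le_iff₀ (by positivity)]
  refine (norm_add_le _ _).trans ?_
  rw [norm_neg, norm_mul (Complex.I * z), norm_mul Complex.I, Complex.norm_I, Complex.norm_real,
      Complex.norm_real, Real.norm_eq_abs, Real.norm_eq_abs, one_mul]
  have h3 : |z| * |Real.sin u - u| ≤ |z| * |u| ^ 3 := by gcongr
  -- The constant in `Complex.exp_bound` for `n = 3` is `4 / 18`.
  have h4 : (|z| * |u|) ^ 3 * ((Nat.succ 3 : ℕ) * ((Nat.factorial 3 : ℕ) * (3 : ℕ) : ℝ)⁻¹) ≤
      (|z| * |u|) ^ 3 := by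
    refine mul_le_of_le_one_right (by positivity) ?_
    simp [Nat.factorial]; norm_num
  nlinarith [h1.trans h4]

lemma continuous_levyKernel (z : ℝ) : Continuous (levyKernel z) := by
  rw [continuous_iff_continuousAt]
  intro u
  rcases eq_or_ne u 0 with rfl | h
  · rw [ContinuousAt, tendsto_iff_norm_sub_tendsto_zero]
    have h0 : Tendsto (fun u : ℝ => (|z| ^ 3 + |z|) * |u|) (𝓝 0) (𝓝 0) := by
      have : Continuous fun u : ℝ => (|z| ^ 3 + |z|) * |u| := by fun_prop
      simpa using this.tendsto 0
    refine tendsto_of_tendsto_of_tendsto_of_le_of_le' tendsto_const_nhds h0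
      (Eventually.of_forall fun _ => norm_nonneg _) ?_
    have c1 : ∀ᶠ u : ℝ in 𝓝 0, |u| < 1 := by
      have : Continuous fun u : ℝ => |u| := by fun_prop
      exact this.continuousAt.eventually_lt continuousAt_const (by simp)
    have c2 : ∀ᶠ u : ℝ in 𝓝 0, |z * u| < 1 := by
      have : Continuous fun u : ℝ => |z * u| := by fun_prop
      exact this.continuousAt.eventually_lt continuousAt_const (by simp)
    filter_upwards [c1, c2] with u h1 h2 using norm_levyKernel_sub_le h1.le h2.le
  · have : levyKernel z =ᶠ[𝓝 u] fun u => (1 - Complex.exp (Complex.I * z * u) +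
        Complex.I * z * Real.sin u) / (u : ℂ) ^ 2 := by
      filter_upwards [isOpen_ne.mem_nhds h] with v hv
      rw [levyKernel, if_neg hv]
    refine ContinuousAt.congr ?_ this.symm
    refine ContinuousAt.div (by fun_prop) (by fun_prop) ?_
    exact pow_ne_zero _ (by exact_mod_cast h)

lemma re_levyKernel {z u : ℝ} (hu : u ≠ 0) :
    (levyKernel z u).re = (1 - Real.cos (z * u)) / u ^ 2 := by
  have h : Complex.I * z * u = ((z * u : ℝ) : ℂ) * Complex.I := by push_cast; ring
  rw [levyKernel, if_neg hu, h, Complex.exp_mul_I, ← Complex.ofReal_pow, Complex.div_ofReal_re,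
    ← Complex.ofReal_cos, ← Complex.ofReal_sin]
  simp [-Complex.ofReal_cos, -Complex.ofReal_sin]

lemma re_levyKernel_zero (z : ℝ) : (levyKernel z 0).re = z ^ 2 / 2 := by
  rw [levyKernel, if_pos rfl]
  have : ((z : ℂ) ^ 2 / 2) = ((z ^ 2 / 2 : ℝ) : ℂ) := by push_cast; ring
  rw [this, Complex.ofReal_re]

lemma re_levyKernel_nonneg (z u : ℝ) : 0 ≤ (levyKernel z u).re := by
  rcases eq_or_ne u 0 with rfl | h
  · rw [re_levyKernel_zero]; positivity
  · rw [re_levyKernel h]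
    exact div_nonneg (by linarith [Real.cos_le_one (z * u)]) (sq_nonneg _)

lemma re_levyKernel_neg (z u : ℝ) : (levyKernel z (-u)).re = (levyKernel z u).re := by
  rcases eq_or_ne u 0 with rfl | h
  · simp
  · rw [re_levyKernel h, re_levyKernel (neg_ne_zero.2 h)]; simp

/-! ### Canonical measures -/

lemma IsCanonical.integrable_levyBound {M : Measure ℝ} (hM : IsCanonical M) :
    Integrable levyBound M := by
  refine ⟨measurable_levyBound.aestronglyMeasurable, ?_⟩
  rw [hasFiniteIntegral_iff_ofReal (Eventually.of_forall levyBound_nonneg)]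
  have hu : (Set.univ : Set ℝ) ⊆ Set.Icc (-1) 1 ∪ (Set.Ici 1 ∪ Set.Iic (-1)) := by
    intro x _
    simp only [Set.mem_union, Set.mem_Icc, Set.mem_Ici, Set.mem_Iic]
    grind
  have hle : ∀ x : ℝ, 1 ≤ |x| → levyBound x ≤ 1 / x ^ 2 := by
    intro x hx
    unfold levyBound
    split_ifs with h
    · have : |x| = 1 := le_antisymm h hx
      rw [← sq_abs, this]; norm_num
    · exact le_rfl
  rw [← setLIntegral_univ]
  refine ((lintegral_mono_set hu).trans ((lintegral_union_le _ _ _).trans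
    (add_le_add_right (lintegral_union_le _ _ _) _))).trans_lt ?_
  refine ENNReal.add_lt_top.2 ⟨?_, ENNReal.add_lt_top.2 ⟨?_, ?_⟩⟩
  · refine lt_of_le_of_lt ?_ (hM.finite_interval (-1) 1)
    rw [← setLIntegral_one]
    refine lintegral_mono fun x => ?_
    rw [← ENNReal.ofReal_one]
    exact ENNReal.ofReal_le_ofReal (levyBound_le_one x)
  · refine lt_of_le_of_lt ?_ (hM.finite_tailPos 1 one_pos)
    refine setLIntegral_mono' measurableSet_Ici fun x hx => ENNReal.ofReal_le_ofReal (hle x ?_)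
    exact (Set.mem_Ici.1 hx).trans (le_abs_self x)
  · refine lt_of_le_of_lt ?_ (hM.finite_tailNeg 1 one_pos)
    refine setLIntegral_mono' measurableSet_Iic fun x hx => ENNReal.ofReal_le_ofReal (hle x ?_)
    have := Set.mem_Iic.1 hx
    linarith [neg_abs_le x]

lemma IsCanonical.integrable_levyKernel {M : Measure ℝ} (hM : IsCanonical M) (z : ℝ) :
    Integrable (levyKernel z) M :=
  (hM.integrable_levyBound.const_mul (4 * (1 + z ^ 2))).mono'
    (continuous_levyKernel z).aestronglyMeasurable
    (Eventually.of_forall fun u => norm_levyKernel_le z u)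

lemma IsCanonical.norm_phi_le {M : Measure ℝ} (hM : IsCanonical M) (z : ℝ) :
    ‖phi M z‖ ≤ 4 * (1 + z ^ 2) * ∫ u, levyBound u ∂M := by
  rw [← integral_const_mul]
  exact norm_integral_le_of_norm_le (hM.integrable_levyBound.const_mul _)
    (Eventually.of_forall fun u => norm_levyKernel_le z u)

lemma IsCanonical.continuous_phi {M : Measure ℝ} (hM : IsCanonical M) : Continuous (phi M) := by
  rw [continuous_iff_continuousAt]
  intro z
  refine continuousAt_of_dominated (bound := fun u => 4 * (1 + (|z| + 1) ^ 2) * levyBound u)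
    (Eventually.of_forall fun w => (continuous_levyKernel w).aestronglyMeasurable) ?_
    (hM.integrable_levyBound.const_mul _)
    (Eventually.of_forall fun u => (continuous_levyKernel_left u).continuousAt)
  have : ∀ᶠ w : ℝ in 𝓝 z, |w| < |z| + 1 :=
    continuous_abs.continuousAt.eventually_lt continuousAt_const (by simp)
  filter_upwards [this] with w hw
  refine Eventually.of_forall fun u => (norm_levyKernel_le w u).trans ?_
  have : w ^ 2 ≤ (|z| + 1) ^ 2 := by
    rw [← sq_abs]; exact pow_le_pow_left₀ (abs_nonneg _) hw.le 2
  have := levyBound_nonneg u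
  gcongr

lemma IsCanonical.re_phi_eq {M : Measure ℝ} (hM : IsCanonical M) (z : ℝ) :
    (phi M z).re = ∫ u, (levyKernel z u).re ∂M :=
  (Complex.reCLM.integral_comp_comm (hM.integrable_levyKernel z)).symm

lemma IsCanonical.re_phi_nonneg {M : Measure ℝ} (hM : IsCanonical M) (z : ℝ) :
    0 ≤ (phi M z).re := by
  rw [hM.re_phi_eq]
  exact integral_nonneg fun u => re_levyKernel_nonneg z u

lemma lintegral_symm_of_even (m : Measure ℝ) {f : ℝ → ENNReal} (hf : Measurable f)
    (heven : ∀ u, f (-u) = f u) : ∫⁻ u, f u ∂(symm m) = ∫⁻ u, f u ∂m := by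
  rw [symm, lintegral_smul_measure, lintegral_add_measure, lintegral_map hf measurable_neg]
  simp only [heven, smul_eq_mul]
  rw [← two_mul, ← mul_assoc, ENNReal.inv_mul_cancel two_ne_zero ENNReal.ofNat_ne_top, one_mul]

/-- The real part of the kernel is even, so only the symmetrization matters. The `lintegral` form
lets an inequality between symmetrizations pass to `Re φ` with no integrability to check. -/
lemma IsCanonical.ofReal_re_phi {M : Measure ℝ} (hM : IsCanonical M) (z : ℝ) :
    ENNReal.ofReal (phi M z).re = ∫⁻ u, ENNReal.ofReal (levyKernel z u).re ∂(symm M) := by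
  have hc : Continuous fun u => (levyKernel z u).re :=
    Complex.continuous_re.comp (continuous_levyKernel z)
  rw [lintegral_symm_of_even M hc.measurable.ennreal_ofReal fun u => by rw [re_levyKernel_neg],
    hM.re_phi_eq]
  exact ofReal_integral_eq_lintegral_ofReal
    (Complex.reCLM.integrable_comp (hM.integrable_levyKernel z))
    (Eventually.of_forall fun u => re_levyKernel_nonneg z u)

lemma IsCanonical.re_phi_mono {M M' : Measure ℝ} (hM : IsCanonical M) (hM' : IsCanonical M')
    (h : symm M ≤ symm M') (z : ℝ) : (phi M z).re ≤ (phi M' z).re := by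
  rw [← ENNReal.ofReal_le_ofReal_iff (hM'.re_phi_nonneg z), hM.ofReal_re_phi, hM'.ofReal_re_phi]
  exact lintegral_mono' h le_rfl

lemma psi_re (β : ℝ) (M : Measure ℝ) (z : ℝ) : (psi β M z).re = (phi M z).re := by
  simp [psi]

lemma IsCanonical.continuous_psi {M : Measure ℝ} (hM : IsCanonical M) (β : ℝ) :
    Continuous (psi β M) := by
  have := hM.continuous_phi
  unfold psi
  fun_prop

lemma IsCanonical.exists_norm_psi_le {M : Measure ℝ} (hM : IsCanonical M) (β : ℝ) :
    ∃ K : ℝ, 0 < K ∧ ∀ z, ‖psi β M z‖ ≤ K * (1 + z ^ 2) := by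
  have h0 : 0 ≤ ∫ u, levyBound u ∂M := integral_nonneg levyBound_nonneg
  refine ⟨|β| + 4 * (∫ u, levyBound u ∂M) + 1, by positivity, fun z => ?_⟩
  have hz : |z| ≤ 1 + z ^ 2 := by nlinarith [sq_nonneg (|z| - 1), sq_abs z, abs_nonneg z]
  have h1 : ‖-Complex.I * β * z‖ ≤ |β| * (1 + z ^ 2) := by
    simp only [neg_mul, norm_neg, norm_mul, Complex.norm_I, Complex.norm_real, Real.norm_eq_abs,
      one_mul]
    gcongr
  have := (norm_add_le (-Complex.I * β * z) (phi M z)).trans (add_le_add h1 (hM.norm_phi_le z))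
  rw [psi]
  nlinarith [sq_nonneg z]

/-- An unbounded real supremum defaults to `0`; boundedness is what makes `gammaRe` an actual bound
for the quotient. -/
lemma bddAbove_gammaRe {M M' : Measure ℝ} (hM : IsCanonical M) (hM' : IsCanonical M') :
    BddAbove (Set.range fun z : ℝ => |(phi M z).re - (phi M' z).re| / (1 + z ^ 2)) := by
  refine ⟨4 * (∫ u, levyBound u ∂M) + 4 * ∫ u, levyBound u ∂M', ?_⟩
  rintro _ ⟨z, rfl⟩
  dsimp only
  rw [div_le_iff₀ (by positivity), ← Complex.sub_re]
  refine (Complex.abs_re_le_norm _).trans ((norm_sub_le _ _).trans ?_)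
  linarith [hM.norm_phi_le z, hM'.norm_phi_le z]

lemma bddAbove_gammaIm {M M' : Measure ℝ} (hM : IsCanonical M) (hM' : IsCanonical M') :
    BddAbove (Set.range fun z : ℝ => |(phi M z).im - (phi M' z).im| / (1 + z ^ 2)) := by
  refine ⟨4 * (∫ u, levyBound u ∂M) + 4 * ∫ u, levyBound u ∂M', ?_⟩
  rintro _ ⟨z, rfl⟩
  dsimp only
  rw [div_le_iff₀ (by positivity), ← Complex.sub_im]
  refine (Complex.abs_im_le_norm _).trans ((norm_sub_le _ _).trans ?_)
  linarith [hM.norm_phi_le z, hM'.norm_phi_le z]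

lemma norm_phi_sub_le {M M' : Measure ℝ} (hM : IsCanonical M) (hM' : IsCanonical M') (z : ℝ) :
    ‖phi M z - phi M' z‖ ≤ (gammaRe M M' + gammaIm M M') * (1 + z ^ 2) := by
  have h1 := le_ciSup (bddAbove_gammaRe hM hM') z
  have h2 := le_ciSup (bddAbove_gammaIm hM hM') z
  rw [div_le_iff₀ (by positivity)] at h1 h2
  refine (Complex.norm_le_abs_re_add_abs_im _).trans ?_
  rw [Complex.sub_re, Complex.sub_im, add_mul]
  exact add_le_add h1 h2

/-! ### The canonical measures of the rows -/

section Row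

variable {G : ℕ → Measure ℝ} {a : ℕ → ℕ} {b : ℕ → ℝ} {n : ℕ}

lemma isProbabilityMeasure_lawX [IsProbabilityMeasure (G n)] :
    IsProbabilityMeasure (lawX G b n) :=
  Measure.isProbabilityMeasure_map (by fun_prop)

lemma charFun_lawX (z : ℝ) : charFun (lawX G b n) z = charFun (G n) (z / b n) := by
  have : (fun x : ℝ => x / b n) = fun x => (b n)⁻¹ * x := by ext; ring
  rw [lawX, this, charFun_map_mul]
  congr 1; ring

lemma isCanonical_canon [IsProbabilityMeasure (G n)] : IsCanonical (canon G a b n) := by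
  have : IsProbabilityMeasure (lawX G b n) := isProbabilityMeasure_lawX
  have hm : Measurable fun u : ℝ => ENNReal.ofReal (a n * u ^ 2) := by fun_prop
  have tail : ∀ s : Set ℝ, MeasurableSet s →
      ∫⁻ u in s, ENNReal.ofReal (1 / u ^ 2) ∂(canon G a b n) < ⊤ := by
    intro s hs
    rw [canon, setLIntegral_withDensity_eq_setLIntegral_mul _ hm (by fun_prop) hs]
    refine lt_of_le_of_lt (lintegral_mono (g := fun _ => ENNReal.ofReal (a n)) fun u => ?_) ?_
    · rw [Pi.mul_apply, ← ENNReal.ofReal_mul (by positivity)]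
      refine ENNReal.ofReal_le_ofReal ?_
      -- The two densities multiply to `a n` off the origin; at `0` the convention `1 / 0 = 0` makes
      -- the product `0`.
      rcases eq_or_ne u 0 with rfl | h
      · simp
      · apply le_of_eq; field_simp
    · rw [setLIntegral_const]
      exact ENNReal.mul_lt_top ENNReal.ofReal_lt_top (measure_lt_top _ _)
  refine ⟨fun s t => ?_, fun x _ => tail _ measurableSet_Ici, fun x _ => tail _ measurableSet_Iic⟩
  rw [canon, withDensity_apply _ measurableSet_Icc]
  refine lt_of_le_of_lt (setLIntegral_mono' (g := fun _ =>
    ENNReal.ofReal (a n * (|s| + |t|) ^ 2)) measurableSet_Icc fun u hu => ?_) ?_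
  · refine ENNReal.ofReal_le_ofReal ?_
    have : |u| ≤ |s| + |t| := by
      have := abs_nonneg s
      have := abs_nonneg t
      rw [abs_le]
      constructor <;> linarith [hu.1, hu.2, neg_abs_le s, le_abs_self t]
    rw [← sq_abs u]
    gcongr
  · rw [setLIntegral_const]
    exact ENNReal.mul_lt_top ENNReal.ofReal_lt_top (measure_lt_top _ _)

lemma integrable_exp_I_mul (P : Measure ℝ) [IsFiniteMeasure P] (z : ℝ) :
    Integrable (fun u : ℝ => Complex.exp (Complex.I * z * u)) P :=
  (integrable_const (1 : ℝ)).mono' (by fun_prop)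
    (Eventually.of_forall fun u => (norm_exp_I_mul_mul z u).le)

lemma charFun_eq_integral_exp_I_mul (P : Measure ℝ) (z : ℝ) :
    charFun P z = ∫ u : ℝ, Complex.exp (Complex.I * z * u) ∂P := by
  rw [charFun_apply_real]
  congr with u
  ring_nf

lemma phi_canon [IsProbabilityMeasure (G n)] (z : ℝ) :
    phi (canon G a b n) z =
      a n * (1 - charFun (lawX G b n) z) + Complex.I * z * (a n * betaN G b n : ℝ) := by
  have : IsProbabilityMeasure (lawX G b n) := isProbabilityMeasure_lawX
  have hm : Measurable fun u : ℝ => (a n * u ^ 2 : ℝ) := by fun_prop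
  rw [phi, canon, integral_withDensity_eq_integral_toReal_smul
    (by fun_prop) (Eventually.of_forall fun u => ENNReal.ofReal_lt_top)]
  have hs : Integrable (fun u : ℝ => Complex.I * z * (Real.sin u : ℂ)) (lawX G b n) := by
    refine Integrable.const_mul ?_ _
    refine (integrable_const (1 : ℝ)).mono' (by fun_prop) (Eventually.of_forall fun u => ?_)
    rw [Complex.norm_real]
    exact Real.abs_sin_le_one u
  have he := integrable_exp_I_mul (lawX G b n) z
  have hd : Integrable (fun u : ℝ => 1 - Complex.exp (Complex.I * z * u)) (lawX G b n) :=
    (integrable_const _).sub he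
  calc _ = ∫ u, (a n : ℂ) * (1 - Complex.exp (Complex.I * z * u) +
        Complex.I * z * (Real.sin u : ℂ)) ∂(lawX G b n) := by
        refine integral_congr_ae (Eventually.of_forall fun u => ?_)
        dsimp only
        rw [← levyKernel_mul_sq, ENNReal.toReal_ofReal (by positivity), Complex.real_smul]
        push_cast; ring
    _ = _ := by
        rw [integral_const_mul, integral_add hd hs,
          integral_sub (integrable_const _) he, integral_const_mul, integral_complex_ofReal,
          ← charFun_eq_integral_exp_I_mul, betaN]
        simp
        ring

/-- The exact identity behind the whole proof: no approximation separates the row from its exponent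
`ψ_n`. -/
lemma mul_one_sub_charFun_lawX [IsProbabilityMeasure (G n)] (z : ℝ) :
    (a n : ℂ) * (1 - charFun (lawX G b n) z) =
      psi (a n * betaN G b n) (canon G a b n) z := by
  rw [psi, phi_canon]
  push_cast; ring

lemma norm_psi_canon_sub_le [IsProbabilityMeasure (G n)] {M : Measure ℝ} (hM : IsCanonical M)
    (β z : ℝ) :
    ‖psi (a n * betaN G b n) (canon G a b n) z - psi β M z‖ ≤
      (chi G a b β n + gammaRe M (canon G a b n) + gammaIm M (canon G a b n)) * (1 + z ^ 2) := by
  have hz : |z| ≤ 1 + z ^ 2 := by nlinarith [sq_nonneg (|z| - 1), sq_abs z, abs_nonneg z]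
  have e : psi (a n * betaN G b n) (canon G a b n) z - psi β M z =
      -(Complex.I * ((a n * betaN G b n - β : ℝ) : ℂ) * z) -
        (phi M z - phi (canon G a b n) z) := by
    rw [psi, psi]; push_cast; ring
  rw [e]
  refine (norm_sub_le _ _).trans ?_
  rw [norm_neg, add_assoc, add_mul]
  refine add_le_add ?_ (norm_phi_sub_le hM isCanonical_canon z)
  rw [norm_mul, norm_mul, Complex.norm_I, Complex.norm_real, Complex.norm_real, one_mul,
    Real.norm_eq_abs, Real.norm_eq_abs, chi]
  gcongr

/-- Translates alternative (a) of Condition F into a lower bound for `Re ψ_n`. -/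
lemma mul_integral_one_sub_cos_symm [IsProbabilityMeasure (G n)] (z : ℝ) :
    (a n : ℝ) * ∫ u, (1 - Real.cos (z * u)) ∂(symm (lawX G b n)) =
      (psi (a n * betaN G b n) (canon G a b n) z).re := by
  have : IsProbabilityMeasure (lawX G b n) := isProbabilityMeasure_lawX
  have h0 : ∀ u : ℝ, 0 ≤ 1 - Real.cos (z * u) := fun u => by linarith [Real.cos_le_one (z * u)]
  rw [← mul_one_sub_charFun_lawX, ← Complex.ofReal_natCast, Complex.re_ofReal_mul]
  congr 1
  rw [charFun_eq_integral_exp_I_mul, integral_eq_lintegral_of_nonneg_ae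
    (Eventually.of_forall h0) (by fun_prop), lintegral_symm_of_even _ (by fun_prop)
    (fun u => by rw [mul_neg, Real.cos_neg]), ← integral_eq_lintegral_of_nonneg_ae
    (Eventually.of_forall h0) (by fun_prop)]
  have he := integrable_exp_I_mul (lawX G b n) z
  have hr : ∀ u : ℝ, (Complex.exp (Complex.I * z * u)).re = Real.cos (z * u) := by
    intro u
    have h : Complex.I * z * u = ((z * u : ℝ) : ℂ) * Complex.I := by push_cast; ring
    rw [h, Complex.exp_ofReal_mul_I_re]
  have h1 : (∫ u : ℝ, Complex.exp (Complex.I * z * u) ∂(lawX G b n)).re =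
      ∫ u : ℝ, Real.cos (z * u) ∂(lawX G b n) := by
    simp_rw [← hr]
    exact (Complex.reCLM.integral_comp_comm he).symm
  have hc : Integrable (fun u : ℝ => Real.cos (z * u)) (lawX G b n) := by
    simp_rw [← hr]
    exact Complex.reCLM.integrable_comp he
  rw [Complex.sub_re, h1, integral_sub (integrable_const _) hc]
  simp

end Row

/-! ### Proper convergence implies convergence of the exponents -/

/-- After normalization to probability measures, the intervals with end points in `D` form a
π-system containing arbitrarily small neighbourhoods of each point, which determines weak
convergence. A zero limit cannot be normalized and is treated apart. -/
lemma tendsto_finiteMeasure_of_tendsto_Icc {D : Set ℝ} (hD : Dense D) {ν : ℕ → FiniteMeasure ℝ}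
    {ν₀ : FiniteMeasure ℝ} (hmass : Tendsto (fun n => (ν n).mass) atTop (𝓝 ν₀.mass))
    (hIcc : ∀ s ∈ D, ∀ t ∈ D, s ≤ t →
      Tendsto (fun n => ν n (Set.Icc s t)) atTop (𝓝 (ν₀ (Set.Icc s t)))) :
    Tendsto ν atTop (𝓝 ν₀) := by
  rcases eq_or_ne ν₀ 0 with rfl | h0
  · rw [FiniteMeasure.zero_mass] at hmass
    exact FiniteMeasure.tendsto_zero_of_tendsto_zero_mass hmass
  have hm0 : ν₀.mass ≠ 0 := ν₀.mass_nonzero_iff.2 h0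
  refine FiniteMeasure.tendsto_of_tendsto_normalize_testAgainstNN_of_tendsto_mass ?_ hmass
  let S : Set (Set ℝ) := {I | ∃ s ∈ D, ∃ t ∈ D, s ≤ t ∧ I = Set.Icc s t}
  have hS : IsPiSystem S := by
    rintro _ ⟨s, hs, t, ht, hst, rfl⟩ _ ⟨s', hs', t', ht', hst', rfl⟩ hne
    rw [Set.Icc_inter_Icc] at hne ⊢
    refine ⟨s ⊔ s', ?_, t ⊓ t', ?_, Set.nonempty_Icc.1 hne, rfl⟩
    · rcases max_choice s s' with h | h <;> rw [h] <;> assumption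
    · rcases min_choice t t' with h | h <;> rw [h] <;> assumption
  refine hS.tendsto_probabilityMeasure_of_tendsto_of_mem ?_ ?_ ?_
  · rintro _ ⟨s, -, t, -, -, rfl⟩
    exact measurableSet_Icc
  · intro u hu x hx
    obtain ⟨e, he, hball⟩ := Metric.isOpen_iff.1 hu x hx
    obtain ⟨s, hs, hs1, hs2⟩ := hD.exists_between (show x - e < x by linarith)
    obtain ⟨t, ht, ht1, ht2⟩ := hD.exists_between (show x < x + e by linarith)
    refine ⟨Set.Icc s t, ⟨s, hs, t, ht, by linarith, rfl⟩, Icc_mem_nhds hs2 ht1, ?_⟩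
    intro y hy
    refine hball ?_
    rw [Real.ball_eq_Ioo]
    exact ⟨hs1.trans_le hy.1, hy.2.trans_lt ht2⟩
  · rintro _ ⟨s, hs, t, ht, hst, rfl⟩
    rw [ν₀.normalize_eq_of_nonzero h0]
    have hev : ∀ᶠ n in atTop, ν n ≠ 0 := by
      filter_upwards [hmass.eventually_ne hm0] with n hn
      exact (ν n).mass_nonzero_iff.1 hn
    refine Tendsto.congr' ?_ ((hmass.inv₀ hm0).mul (hIcc s hs t ht hst))
    filter_upwards [hev] with n hn
    rw [(ν n).normalize_eq_of_nonzero hn]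

lemma tailPos_antitone (M : Measure ℝ) {s t : ℝ} (h : s ≤ t) : tailPos M t ≤ tailPos M s :=
  lintegral_mono_set (Set.Ici_subset_Ici.2 h)

lemma tailNeg_antitone (M : Measure ℝ) {s t : ℝ} (h : s ≤ t) : tailNeg M t ≤ tailNeg M s :=
  lintegral_mono_set (Set.Iic_subset_Iic.2 (neg_le_neg h))

lemma IsCanonical.tendsto_tailPos {M : Measure ℝ} (hM : IsCanonical M) :
    Tendsto (tailPos M) atTop (𝓝 0) := by
  have h : ∀ x, tailPos M x =
      M.withDensity (fun u => ENNReal.ofReal (1 / u ^ 2)) (Set.Ici x) := fun x => by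
    rw [withDensity_apply _ measurableSet_Ici]; rfl
  have := tendsto_measure_iInter_atTop
    (μ := M.withDensity (fun u => ENNReal.ofReal (1 / u ^ 2))) (s := fun x : ℝ => Set.Ici x)
    (fun i => measurableSet_Ici.nullMeasurableSet) (fun s t h => Set.Ici_subset_Ici.2 h)
    ⟨1, by rw [← h]; exact (hM.finite_tailPos 1 one_pos).ne⟩
  have he : ⋂ x : ℝ, Set.Ici x = ∅ := by
    ext y
    simp only [Set.mem_iInter, Set.mem_Ici, Set.mem_empty_iff_false, iff_false, not_forall, not_le]
    exact ⟨y + 1, by linarith⟩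
  rw [he, measure_empty] at this
  exact this.congr fun x => (h x).symm

lemma IsCanonical.tendsto_tailNeg {M : Measure ℝ} (hM : IsCanonical M) :
    Tendsto (tailNeg M) atTop (𝓝 0) := by
  have h : ∀ x, tailNeg M x =
      M.withDensity (fun u => ENNReal.ofReal (1 / u ^ 2)) (Set.Iic (-x)) := fun x => by
    rw [withDensity_apply _ measurableSet_Iic]; rfl
  have := tendsto_measure_iInter_atTop
    (μ := M.withDensity (fun u => ENNReal.ofReal (1 / u ^ 2))) (s := fun x : ℝ => Set.Iic (-x))
    (fun i => measurableSet_Iic.nullMeasurableSet)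
    (fun s t h => Set.Iic_subset_Iic.2 (neg_le_neg h))
    ⟨1, by rw [← h]; exact (hM.finite_tailNeg 1 one_pos).ne⟩
  have he : ⋂ x : ℝ, Set.Iic (-x) = ∅ := by
    ext y
    simp only [Set.mem_iInter, Set.mem_Iic, Set.mem_empty_iff_false, iff_false, not_forall, not_le]
    exact ⟨-y + 1, by linarith⟩
  rw [he, measure_empty] at this
  exact this.congr fun x => (h x).symm

lemma IsCanonical.norm_setIntegral_compl_le {M : Measure ℝ} (hM : IsCanonical M) (z : ℝ) {T : ℝ}
    (hT : 0 < T) :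
    ‖∫ u in (Set.Icc (-T) T)ᶜ, levyKernel z u ∂M‖ ≤
      (2 + |z|) * (tailPos M T + tailNeg M T).toReal := by
  have hfin : tailPos M T + tailNeg M T ≠ ⊤ :=
    (ENNReal.add_lt_top.2 ⟨hM.finite_tailPos T hT, hM.finite_tailNeg T hT⟩).ne
  have hpt : ∀ u : ℝ, T ≤ |u| → ENNReal.ofReal ‖levyKernel z u‖ ≤
      ENNReal.ofReal (2 + |z|) * ENNReal.ofReal (1 / u ^ 2) := by
    intro u hu
    rw [← ENNReal.ofReal_mul (by positivity)]
    refine ENNReal.ofReal_le_ofReal ?_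
    rw [mul_one_div]
    refine norm_levyKernel_le_div ?_
    rintro rfl
    rw [abs_zero] at hu
    linarith
  have hle : ∫⁻ u in (Set.Icc (-T) T)ᶜ, ENNReal.ofReal ‖levyKernel z u‖ ∂M ≤
      ENNReal.ofReal (2 + |z|) * (tailPos M T + tailNeg M T) := by
    have hsub : (Set.Icc (-T) T)ᶜ ⊆ Set.Ici T ∪ Set.Iic (-T) := by
      intro x hx
      simp only [Set.mem_compl_iff, Set.mem_Icc, Set.mem_union, Set.mem_Ici, Set.mem_Iic] at *
      grind
    refine (lintegral_mono_set hsub).trans ((lintegral_union_le _ _ _).trans ?_)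
    rw [mul_add, tailPos, tailNeg, ← lintegral_const_mul _ (by fun_prop),
      ← lintegral_const_mul _ (by fun_prop)]
    refine add_le_add ?_ ?_
    · exact setLIntegral_mono' measurableSet_Ici fun u hu =>
        hpt u ((Set.mem_Ici.1 hu).trans (le_abs_self u))
    · exact setLIntegral_mono' measurableSet_Iic fun u hu =>
        hpt u (by linarith [Set.mem_Iic.1 hu, neg_abs_le u])
  refine (norm_integral_le_lintegral_norm _).trans ?_
  refine (ENNReal.toReal_mono (ENNReal.mul_ne_top ENNReal.ofReal_ne_top hfin) hle).trans_eq ?_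
  rw [ENNReal.toReal_mul, ENNReal.toReal_ofReal (by positivity)]

lemma IsCanonical.isLocallyFiniteMeasure {M : Measure ℝ} (hM : IsCanonical M) :
    IsLocallyFiniteMeasure M :=
  ⟨fun x => ⟨Set.Icc (x - 1) (x + 1), Icc_mem_nhds (by linarith) (by linarith),
    hM.finite_interval _ _⟩⟩

lemma IsCanonical.countable_atoms {M : Measure ℝ} (hM : IsCanonical M) :
    {x : ℝ | M {x} ≠ 0}.Countable := by
  have := hM.isLocallyFiniteMeasure
  have := Measure.countable_meas_pos_of_disjoint_iUnion (μ := M) (As := fun x : ℝ => {x})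
    (fun x => measurableSet_singleton x)
    (fun s t hst => by simpa using hst)
  refine this.mono fun x hx => ?_
  exact pos_iff_ne_zero.2 hx

/-- The Lévy kernel as a bounded continuous function. -/
def levyKernelBCF (z : ℝ) : BoundedContinuousFunction ℝ ℂ :=
  BoundedContinuousFunction.ofNormedAddCommGroup (levyKernel z) (continuous_levyKernel z)
    (4 * (1 + z ^ 2)) fun u => (norm_levyKernel_le z u).trans
      (mul_le_of_le_one_right (by positivity) (levyBound_le_one u))

/-- On `[-T, T]`, with `±T` not atoms of `M`, the restricted measures converge weakly and the kernel
is a bounded continuous test function. Outside, the kernel is at most `(2 + |z|) / u²`, so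
convergence of the tails makes the remainder uniformly small. -/
theorem tendsto_phi_of_convergesProperly {Mn : ℕ → Measure ℝ} {M : Measure ℝ}
    (hMn : ∀ n, IsCanonical (Mn n)) (hatom : ∀ n x, Mn n {x} = 0) (hM : IsCanonical M)
    (h : ConvergesProperly Mn M) (z : ℝ) :
    Tendsto (fun n => phi (Mn n) z) atTop (𝓝 (phi M z)) := by
  set D : Set ℝ := {x | M {x} ≠ 0}ᶜ with hDdef
  have hD : Dense D := hM.countable_atoms.dense_compl ℝ
  have hD' : Dense {x : ℝ | M {x} = 0 ∧ M {-x} = 0} := by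
    have hc : ({x : ℝ | M {x} ≠ 0} ∪ {x : ℝ | M {-x} ≠ 0}).Countable :=
      hM.countable_atoms.union (hM.countable_atoms.preimage neg_injective)
    refine (hc.dense_compl ℝ).mono fun x hx => ?_
    simpa [not_or] using hx
  have hmemD : ∀ {x}, x ∈ D ↔ M {x} = 0 := fun {x} => by simp [hDdef]
  have hIcc : ∀ s t : ℝ, M {s} = 0 → M {t} = 0 →
      Tendsto (fun n => Mn n (Set.Icc s t)) atTop (𝓝 (M (Set.Icc s t))) := by
    intro s t hs ht
    rcases lt_trichotomy s t with hst | rfl | hst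
    · exact h.interval s t hst hs ht
    -- Proper convergence speaks only of `s < t`; intersecting with `[-T, T]` below may produce a
    -- single point, where the absence of atoms of `Mn n` is needed.
    · simp [hatom, hs]
    · simp [Set.Icc_eq_empty_of_lt hst]
  rw [Metric.tendsto_atTop']
  intro e he
  have hK : 0 < 2 + |z| := by positivity
  -- Chosen so that each of the two tail integrals is below `e / 4`.
  set η : ℝ := e / (4 * (2 + |z|)) with hη
  have hη0 : 0 < η := by positivity
  have htail : Tendsto (fun T => tailPos M T + tailNeg M T) atTop (𝓝 0) := by
    simpa using hM.tendsto_tailPos.add hM.tendsto_tailNeg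
  obtain ⟨T₀, hT₀, hT₀'⟩ := ((htail.eventually_lt_const
    (ENNReal.ofReal_pos.2 hη0)).and (eventually_gt_atTop 0)).exists
  obtain ⟨T, ⟨hT1, hT2⟩, hTT, -⟩ := hD'.exists_between (show T₀ < T₀ + 1 by linarith)
  have hTpos : 0 < T := hT₀'.trans hTT
  have hTt : tailPos M T + tailNeg M T < ENNReal.ofReal η :=
    (add_le_add (tailPos_antitone M hTT.le) (tailNeg_antitone M hTT.le)).trans_lt hT₀
  have hTn : ∀ᶠ n in atTop, tailPos (Mn n) T + tailNeg (Mn n) T < ENNReal.ofReal η :=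
    ((h.tail_pos T hTpos hT1).add (h.tail_neg T hTpos hT2)).eventually_lt_const hTt
  set I := Set.Icc (-T) T with hI
  let ν : ℕ → FiniteMeasure ℝ := fun n => ⟨(Mn n).restrict I,
    ⟨by rw [Measure.restrict_apply_univ]; exact (hMn n).finite_interval _ _⟩⟩
  let ν₀ : FiniteMeasure ℝ := ⟨M.restrict I,
    ⟨by rw [Measure.restrict_apply_univ]; exact hM.finite_interval _ _⟩⟩
  have key : ∀ A : Set ℝ, MeasurableSet A → (∃ s t, M {s} = 0 ∧ M {t} = 0 ∧ A ∩ I = Set.Icc s t) →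
      Tendsto (fun n => ν n A) atTop (𝓝 (ν₀ A)) := by
    rintro A hA ⟨s, t, hs, ht, hst⟩
    have h1 : ∀ n, ν n A = (Mn n (Set.Icc s t)).toNNReal := fun n => by
      change ((Mn n).restrict I A).toNNReal = _
      rw [Measure.restrict_apply hA, hst]
    have h2 : ν₀ A = (M (Set.Icc s t)).toNNReal := by
      change (M.restrict I A).toNNReal = _
      rw [Measure.restrict_apply hA, hst]
    simp_rw [h1, h2]
    exact (ENNReal.tendsto_toNNReal (hM.finite_interval s t).ne).comp (hIcc s t hs ht)
  have hν : Tendsto ν atTop (𝓝 ν₀) := by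
    refine tendsto_finiteMeasure_of_tendsto_Icc hD ?_ ?_
    · exact key Set.univ MeasurableSet.univ ⟨-T, T, hT2, hT1, by rw [Set.univ_inter]⟩
    · intro s hs t ht _
      refine key _ measurableSet_Icc ⟨s ⊔ -T, t ⊓ T, ?_, ?_, by rw [hI, Set.Icc_inter_Icc]⟩
      · rcases max_choice s (-T) with h | h <;> rw [h]
        exacts [hmemD.1 hs, hT2]
      · rcases min_choice t T with h | h <;> rw [h]
        exacts [hmemD.1 ht, hT1]
  have hlim := (FiniteMeasure.tendsto_iff_forall_integral_rclike_tendsto ℂ).1 hν (levyKernelBCF z)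
  obtain ⟨N, hN⟩ := (Metric.tendsto_atTop'.1 hlim) (e / 2) (by positivity)
  obtain ⟨N', hN'⟩ := eventually_atTop.1 hTn
  refine ⟨max N N', fun n hn => ?_⟩
  have hn1 := hN n (lt_of_le_of_lt (le_max_left _ _) hn)
  have hn2 := hN' n ((le_max_right _ _).trans hn.le)
  have split : ∀ m : Measure ℝ, IsCanonical m →
      phi m z = ∫ u in I, levyKernel z u ∂m + ∫ u in Iᶜ, levyKernel z u ∂m := fun m hm =>
    (integral_add_compl measurableSet_Icc (hm.integrable_levyKernel z)).symm
  have tl : ∀ m : Measure ℝ, IsCanonical m → tailPos m T + tailNeg m T < ENNReal.ofReal η →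
      ‖∫ u in Iᶜ, levyKernel z u ∂m‖ < e / 4 := by
    intro m hm hlt
    refine (hm.norm_setIntegral_compl_le z hTpos).trans_lt ?_
    have : (tailPos m T + tailNeg m T).toReal < η := by
      rw [← ENNReal.toReal_ofReal hη0.le]
      exact ENNReal.toReal_strict_mono ENNReal.ofReal_ne_top hlt
    calc _ < (2 + |z|) * η := by gcongr
      _ = e / 4 := by rw [hη]; field_simp
  have t1 := tl _ (hMn n) hn2
  have t2 := tl _ hM hTt
  rw [dist_eq_norm] at hn1 ⊢
  change ‖∫ u in I, levyKernel z u ∂(Mn n) - ∫ u in I, levyKernel z u ∂M‖ < e / 2 at hn1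
  rw [split _ (hMn n), split _ hM, add_sub_add_comm]
  refine (norm_add_le _ _).trans_lt ?_
  have := norm_sub_le (∫ u in Iᶜ, levyKernel z u ∂(Mn n)) (∫ u in Iᶜ, levyKernel z u ∂M)
  linarith

/-! ### Powers of characteristic functions and the limit law -/

lemma norm_pow_sub_pow_le_of_norm_le {x y : ℂ} {R : ℝ} (hx : ‖x‖ ≤ R) (hy : ‖y‖ ≤ R) (m : ℕ) :
    ‖x ^ (m + 1) - y ^ (m + 1)‖ ≤ (m + 1 : ℕ) * R ^ m * ‖x - y‖ := by
  have hR : 0 ≤ R := (norm_nonneg x).trans hx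
  induction m with
  | zero => simp
  | succ m ih =>
    have e : x ^ (m + 1 + 1) - y ^ (m + 1 + 1) =
        (x ^ (m + 1) - y ^ (m + 1)) * x + y ^ (m + 1) * (x - y) := by ring
    rw [e]
    refine (norm_add_le _ _).trans ?_
    rw [norm_mul, norm_mul, norm_pow]
    have h1 : ‖x ^ (m + 1) - y ^ (m + 1)‖ * ‖x‖ ≤ ((m + 1 : ℕ) * R ^ m * ‖x - y‖) * R := by
      gcongr
    have h2 : ‖y‖ ^ (m + 1) * ‖x - y‖ ≤ R ^ (m + 1) * ‖x - y‖ := by gcongr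
    refine (add_le_add h1 h2).trans_eq ?_
    push_cast
    ring

/-- Write `e^{-w}` as the `m`-th power of `e^{-w/m} = 1 - w/m + O(|w|²/m²)` and telescope. Keeping
`R ^ (m - 1)` rather than `1` preserves the decay needed for integration in `z`. -/
lemma norm_pow_sub_exp_neg_le {f w : ℂ} {R : ℝ} {m : ℕ} (hm : 0 < m) (hw : 0 ≤ w.re)
    (hf : ‖f‖ ≤ R) (he : Real.exp (-(w.re / m)) ≤ R) :
    ‖f ^ m - Complex.exp (-w)‖ ≤
      R ^ (m - 1) * (‖(m : ℂ) * (1 - f) - w‖ + 3 * ‖w‖ ^ 2 / m) := by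
  obtain ⟨k, rfl⟩ : ∃ k, m = k + 1 := ⟨m - 1, by omega⟩
  have hm' : (0 : ℝ) < (k + 1 : ℕ) := by positivity
  have hmc : ((k + 1 : ℕ) : ℂ) ≠ 0 := by exact_mod_cast Nat.succ_ne_zero k
  have hR : 0 ≤ R := (norm_nonneg f).trans hf
  have hpow : Complex.exp (-w) = Complex.exp (-(w / (k + 1 : ℕ))) ^ (k + 1) := by
    rw [← Complex.exp_nat_mul]
    congr 1
    field_simp
  have hre : (w / (k + 1 : ℕ)).re = w.re / (k + 1 : ℕ) := by
    rw [← Complex.ofReal_natCast, Complex.div_ofReal_re]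
  have hn : ‖Complex.exp (-(w / (k + 1 : ℕ)))‖ ≤ R := by
    rw [Complex.norm_exp, Complex.neg_re, hre]; exact he
  rw [hpow]
  refine (norm_pow_sub_pow_le_of_norm_le hf hn k).trans ?_
  rw [Nat.add_sub_cancel, mul_comm ((k + 1 : ℕ) : ℝ), mul_assoc]
  refine mul_le_mul_of_nonneg_left ?_ (pow_nonneg hR _)
  have h3 := norm_exp_sub_one_sub_id_le_of_re_nonpos (w := -(w / (k + 1 : ℕ)))
    (by rw [Complex.neg_re, hre]; exact neg_nonpos.2 (by positivity))
  have e : ((k + 1 : ℕ) : ℂ) * (f - Complex.exp (-(w / (k + 1 : ℕ)))) =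
      -((((k + 1 : ℕ) : ℂ) * (1 - f) - w) + ((k + 1 : ℕ) : ℂ) *
        (Complex.exp (-(w / (k + 1 : ℕ))) - 1 - -(w / (k + 1 : ℕ)))) := by
    field_simp
    ring
  have e' : ((k + 1 : ℕ) : ℝ) * ‖f - Complex.exp (-(w / (k + 1 : ℕ)))‖ =
      ‖((k + 1 : ℕ) : ℂ) * (f - Complex.exp (-(w / (k + 1 : ℕ))))‖ := by
    rw [norm_mul, Complex.norm_natCast]
  rw [e', e, norm_neg]
  refine (norm_add_le _ _).trans (add_le_add_right ?_ _)
  rw [norm_mul, Complex.norm_natCast]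
  refine (mul_le_mul_of_nonneg_left h3 hm'.le).trans_eq ?_
  rw [norm_neg, norm_div, Complex.norm_natCast]
  field_simp

lemma tendsto_pow_exp_neg {f : ℕ → ℂ} {m : ℕ → ℕ} {w : ℂ} (hm : Tendsto m atTop atTop)
    (hf : ∀ n, ‖f n‖ ≤ 1) (hw : 0 ≤ w.re)
    (h : Tendsto (fun n => (m n : ℂ) * (1 - f n)) atTop (𝓝 w)) :
    Tendsto (fun n => f n ^ m n) atTop (𝓝 (Complex.exp (-w))) := by
  rw [tendsto_iff_norm_sub_tendsto_zero] at h ⊢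
  have hmR : Tendsto (fun n => (m n : ℝ)) atTop atTop := tendsto_natCast_atTop_atTop.comp hm
  have h2 : Tendsto (fun n => ‖(m n : ℂ) * (1 - f n) - w‖ + 3 * ‖w‖ ^ 2 / m n) atTop (𝓝 0) := by
    simpa using h.add (hmR.const_div_atTop (3 * ‖w‖ ^ 2))
  refine tendsto_of_tendsto_of_tendsto_of_le_of_le' tendsto_const_nhds h2
    (Eventually.of_forall fun _ => norm_nonneg _) ?_
  filter_upwards [hm.eventually_gt_atTop 0] with n hn
  refine (norm_pow_sub_exp_neg_le (R := 1) hn hw (hf n) ?_).trans_eq (by rw [one_pow, one_mul])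
  exact Real.exp_le_one_iff.2 (neg_nonpos.2 (by positivity))

/-- Lévy's continuity theorem: continuity at `0` gives tightness, a cluster point along an
ultrafilter has characteristic function `f`, and convergence to this law then follows from that of
the characteristic functions. -/
lemma exists_tendsto_of_tendsto_charFun {ν : ℕ → ProbabilityMeasure ℝ} {f : ℝ → ℂ}
    (hf : ContinuousAt f 0)
    (h : ∀ z, Tendsto (fun n => charFun (ν n : Measure ℝ) z) atTop (𝓝 (f z))) :
    ∃ P : ProbabilityMeasure ℝ, (∀ z, charFun (P : Measure ℝ) z = f z) ∧
      Tendsto ν atTop (𝓝 P) := by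
  have htight : IsTightMeasureSet (Set.range fun n => (ν n : Measure ℝ)) :=
    isTightMeasureSet_of_tendsto_charFun hf h
  have hcomp : IsCompact (closure (Set.range ν)) := by
    refine isCompact_closure_of_isTightMeasureSet ?_
    convert htight using 1
    ext m
    simp
  let U : Ultrafilter ℕ := Ultrafilter.of atTop
  have hU : (U : Filter ℕ) ≤ atTop := Ultrafilter.of_le atTop
  obtain ⟨P, -, hP⟩ := hcomp.ultrafilter_le_nhds (U.map ν)
    (le_principal_iff.2 (mem_of_superset (Filter.range_mem_map) subset_closure))
  have hP' : Tendsto ν U (𝓝 P) := hP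
  have hchar : ∀ z, charFun (P : Measure ℝ) z = f z := by
    intro z
    refine tendsto_nhds_unique ?_ ((h z).mono_left hU)
    rw [ProbabilityMeasure.tendsto_iff_forall_integral_rclike_tendsto ℂ] at hP'
    simp_rw [charFun_eq_integral_innerProbChar]
    exact hP' (BoundedContinuousFunction.innerProbChar z)
  refine ⟨P, hchar, ProbabilityMeasure.tendsto_of_tendsto_charFun fun z => ?_⟩
  rw [hchar]
  exact h z

lemma charFun_map_sum_pi (ν : Measure ℝ) [IsProbabilityMeasure ν] (k : ℕ) (z : ℝ) :
    charFun ((Measure.pi (fun _ : Fin k => ν)).map (fun x => ∑ i, x i)) z = charFun ν z ^ k := by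
  rw [charFun_map_sum_pi_eq_prod]
  simp

lemma tendsto_natCast_div_div {a : ℕ → ℕ} (ha : Tendsto a atTop atTop) {k : ℕ} (hk : 0 < k) :
    Tendsto (fun n => ((a n / k : ℕ) : ℝ) / a n) atTop (𝓝 (1 / k)) := by
  have haR : Tendsto (fun n => (a n : ℝ)) atTop atTop := tendsto_natCast_atTop_atTop.comp ha
  have h0 : Tendsto (fun n => 1 / (a n : ℝ)) atTop (𝓝 0) := haR.const_div_atTop 1
  rw [tendsto_iff_norm_sub_tendsto_zero]
  refine tendsto_of_tendsto_of_tendsto_of_le_of_le' tendsto_const_nhds h0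
    (Eventually.of_forall fun _ => norm_nonneg _) ?_
  filter_upwards [ha.eventually_gt_atTop 0] with n hn
  have hk' : (0 : ℝ) < k := by exact_mod_cast hk
  have hn' : (0 : ℝ) < a n := by exact_mod_cast hn
  have h1 : ((a n / k : ℕ) : ℝ) ≤ a n / k := Nat.cast_div_le
  have h2 : (a n : ℝ) / k ≤ ((a n / k : ℕ) : ℝ) + 1 := by
    have := Nat.lt_div_mul_add (a := a n) hk
    rw [div_le_iff₀ hk']
    have h3 : a n ≤ (a n / k + 1) * k := by rw [add_mul, one_mul]; exact this.le
    exact_mod_cast h3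
  rw [Real.norm_eq_abs, abs_le]
  constructor
  · rw [neg_le_sub_iff_le_add, ← add_div, le_div_iff₀ hn']
    calc 1 / (k : ℝ) * a n = a n / k := by ring
      _ ≤ _ := h2
  · rw [sub_le_iff_le_add, div_le_iff₀ hn', add_mul, one_div_mul_cancel hn'.ne']
    calc ((a n / k : ℕ) : ℝ) ≤ a n / k := h1
      _ = 1 / (k : ℝ) * a n := by ring
      _ ≤ _ := by linarith

/-- The root is the limit law of sums of `⌊a_n / k⌋` variables of the row: since `⌊a_n / k⌋ / a_n →
1 / k`, the exponents converge to `ψ / k`. -/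
lemma exists_charFun_eq_exp_neg_div {L : ℕ → Measure ℝ} [∀ n, IsProbabilityMeasure (L n)]
    {a : ℕ → ℕ} (ha : Tendsto a atTop atTop) {ψ : ℝ → ℂ} (hψ : Continuous ψ)
    (hre : ∀ z, 0 ≤ (ψ z).re)
    (hlim : ∀ z, Tendsto (fun n => (a n : ℂ) * (1 - charFun (L n) z)) atTop (𝓝 (ψ z)))
    {k : ℕ} (hk : 0 < k) :
    ∃ ν : Measure ℝ, IsProbabilityMeasure ν ∧
      ∀ z, charFun ν z = Complex.exp (-(ψ z / k)) := by
  let Q : ℕ → ProbabilityMeasure ℝ := fun n =>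
    ⟨(Measure.pi (fun _ : Fin (a n / k) => L n)).map (fun x => ∑ i, x i),
      Measure.isProbabilityMeasure_map (by fun_prop)⟩
  have hQ : ∀ z, Tendsto (fun n => charFun (Q n : Measure ℝ) z) atTop
      (𝓝 (Complex.exp (-(ψ z / k)))) := by
    intro z
    have e : ∀ n, charFun (Q n : Measure ℝ) z = charFun (L n) z ^ (a n / k) := fun n =>
      charFun_map_sum_pi _ _ _
    simp_rw [e]
    refine tendsto_pow_exp_neg (m := fun n => a n / k)
      ((Nat.tendsto_div_const_atTop hk.ne').comp ha) (fun n => norm_charFun_le_one z) ?_ ?_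
    · rw [← Complex.ofReal_natCast, Complex.div_ofReal_re]
      exact div_nonneg (hre z) (by positivity)
    · have h1 : Tendsto (fun n => (((a n / k : ℕ) : ℝ) / a n : ℝ) • ((a n : ℂ) *
          (1 - charFun (L n) z))) atTop (𝓝 ((1 / k : ℝ) • ψ z)) :=
        (tendsto_natCast_div_div ha hk).smul (hlim z)
      have h2 : (1 / k : ℝ) • ψ z = ψ z / k := by
        rw [Complex.real_smul]; push_cast; ring
      rw [h2] at h1
      refine h1.congr' ?_
      filter_upwards [ha.eventually_gt_atTop 0] with n hn
      have : (a n : ℂ) ≠ 0 := by exact_mod_cast hn.ne'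
      rw [Complex.real_smul]
      push_cast
      field_simp
  obtain ⟨P, hP, -⟩ := exists_tendsto_of_tendsto_charFun (f := fun z => Complex.exp (-(ψ z / k)))
    (by fun_prop) hQ
  exact ⟨P, inferInstance, hP⟩

lemma isInfinitelyDivisible_of_charFun {P : Measure ℝ} [IsProbabilityMeasure P] {ψ : ℝ → ℂ}
    (hP : ∀ z, charFun P z = Complex.exp (-ψ z))
    (h : ∀ k : ℕ, 0 < k → ∃ ν : Measure ℝ, IsProbabilityMeasure ν ∧
      ∀ z, charFun ν z = Complex.exp (-(ψ z / k))) : IsInfinitelyDivisible P := by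
  intro k hk
  obtain ⟨ν, hν, hc⟩ := h k hk
  have : IsProbabilityMeasure ((Measure.pi (fun _ : Fin k => ν)).map (fun x => ∑ i, x i)) :=
    Measure.isProbabilityMeasure_map (by fun_prop)
  refine ⟨ν, hν, Measure.ext_of_charFun ?_⟩
  ext z
  have hk' : (k : ℂ) ≠ 0 := by exact_mod_cast hk.ne'
  rw [charFun_map_sum_pi, hc, hP, ← Complex.exp_nat_mul]
  congr 1
  field_simp

/-! ### The law of the row sums -/

section RowSum

variable {Ω : ℕ → Type*} [∀ n, MeasurableSpace (Ω n)] {μ : (n : ℕ) → Measure (Ω n)}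
  {a : ℕ → ℕ} {b : ℕ → ℝ} {ξ : (n : ℕ) → Fin (a n) → Ω n → ℝ}
  {G : ℕ → Measure ℝ}

lemma measurable_rowSum (hξ_meas : ∀ n k, Measurable (ξ n k)) (n : ℕ) :
    Measurable (rowSum ξ b n) := by
  have := hξ_meas n
  unfold rowSum
  fun_prop

lemma charFun_map_rowSum (hξ_meas : ∀ n k, Measurable (ξ n k))
    (hξ_law : ∀ n k, (μ n).map (ξ n k) = G n) (hξ_indep : ∀ n, iIndepFun (ξ n) (μ n))
    (n : ℕ) (z : ℝ) :
    charFun ((μ n).map (rowSum ξ b n)) z = charFun (lawX G b n) z ^ a n := by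
  have e : rowSum ξ b n = fun ω => (b n)⁻¹ * (∑ k, ξ n k ω) := by
    ext ω; rw [rowSum, div_eq_inv_mul]
  have hm : AEMeasurable (fun ω => ∑ k, ξ n k ω) (μ n) := by
    have := hξ_meas n
    fun_prop
  rw [e, charFun_map_mul_comp hm, (hξ_indep n).charFun_map_fun_sum_eq_prod
    (fun k => (hξ_meas n k).aemeasurable), charFun_lawX]
  simp only [hξ_law, Finset.prod_const, Finset.card_univ, Fintype.card_fin, Pi.pow_apply]
  rw [div_eq_inv_mul]

/-- Convolving with one absolutely continuous summand is enough. This serves the rows with a single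
variable, whose characteristic function need not be integrable. -/
lemma map_rowSum_absolutelyContinuous [∀ n, IsProbabilityMeasure (μ n)] (ha_pos : ∀ n, 0 < a n) (hb_pos : ∀ n, 0 < b n)
    (hξ_meas : ∀ n k, Measurable (ξ n k)) (hξ_law : ∀ n k, (μ n).map (ξ n k) = G n)
    (hξ_indep : ∀ n, iIndepFun (ξ n) (μ n)) (n : ℕ) (hG : G n ≪ volume) :
    (μ n).map (rowSum ξ b n) ≪ volume := by
  let k₀ : Fin (a n) := ⟨0, ha_pos n⟩
  have hm := hξ_meas n
  have : IsProbabilityMeasure (G n) := by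
    rw [← hξ_law n k₀]
    exact Measure.isProbabilityMeasure_map (hm k₀).aemeasurable
  have hind : IndepFun (∑ j ∈ Finset.univ.erase k₀, ξ n j) (ξ n k₀) (μ n) :=
    (hξ_indep n).indepFun_finsetSum_of_notMem hm (Finset.notMem_erase k₀ _)
  have hsum : (fun ω => ∑ k, ξ n k ω) = ∑ j ∈ Finset.univ.erase k₀, ξ n j + ξ n k₀ := by
    rw [Finset.sum_erase_add _ _ (Finset.mem_univ k₀)]
    ext ω
    simp
  have hconv : (μ n).map (fun ω => ∑ k, ξ n k ω) ≪ volume := by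
    have hms : Measurable (∑ j ∈ Finset.univ.erase k₀, ξ n j) := by fun_prop
    have : IsProbabilityMeasure ((μ n).map (∑ j ∈ Finset.univ.erase k₀, ξ n j)) :=
      Measure.isProbabilityMeasure_map hms.aemeasurable
    rw [hsum, hind.map_add_eq_map_conv_map₀ hms.aemeasurable (hm k₀).aemeasurable, hξ_law]
    exact Measure.conv_absolutelyContinuous hG
  have e : rowSum ξ b n = (fun x => (b n)⁻¹ * x) ∘ fun ω => ∑ k, ξ n k ω := by
    ext ω; rw [rowSum, div_eq_inv_mul]; rfl
  rw [e, ← Measure.map_map (by fun_prop) (by fun_prop)]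
  refine (hconv.map (by fun_prop)).trans ?_
  rw [Real.map_volume_mul_left (inv_ne_zero (hb_pos n).ne')]
  exact Measure.smul_absolutelyContinuous

end RowSum

/-! ### Fourier inversion for probability measures -/

/-- The Fourier transform of `z ↦ exp (-b z²)`. -/
def gaussKernel (b s : ℝ) : ℝ := √(Real.pi / b) * Real.exp (-(4 * b)⁻¹ * s ^ 2)

lemma gaussKernel_nonneg (b s : ℝ) : 0 ≤ gaussKernel b s := by
  unfold gaussKernel; positivity

@[fun_prop]
lemma continuous_gaussKernel (b : ℝ) : Continuous (gaussKernel b) := by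
  unfold gaussKernel; fun_prop

lemma lintegral_gaussKernel {b : ℝ} (hb : 0 < b) :
    ∫⁻ s, ENNReal.ofReal (gaussKernel b s) = ENNReal.ofReal (2 * Real.pi) := by
  have hi : Integrable (gaussKernel b) :=
    (integrable_exp_neg_mul_sq (by positivity : 0 < (4 * b)⁻¹)).const_mul _
  rw [← ofReal_integral_eq_lintegral_ofReal hi (Eventually.of_forall (gaussKernel_nonneg b))]
  congr 1
  unfold gaussKernel
  rw [integral_const_mul, integral_gaussian, ← Real.sqrt_mul (by positivity)]
  rw [Real.sqrt_eq_iff_mul_self_eq (by positivity) (by positivity)]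
  field_simp
  ring

lemma integral_exp_mul_gaussian {b : ℝ} (hb : 0 < b) (s : ℝ) :
    ∫ z : ℝ, Complex.exp (Complex.I * s * z) * (Real.exp (-b * z ^ 2) : ℂ) =
      (gaussKernel b s : ℂ) := by
  have h := fourierIntegral_gaussian (b := (b : ℂ)) (by simpa using hb) (s : ℂ)
  have e : ∀ z : ℝ, ((Real.exp (-b * z ^ 2) : ℝ) : ℂ) = Complex.exp (-b * (z : ℂ) ^ 2) := by
    intro z; push_cast; rfl
  simp_rw [e]
  rw [h, gaussKernel, Real.sqrt_eq_rpow]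
  push_cast [Complex.ofReal_cpow (by positivity : 0 ≤ Real.pi / b)]
  congr 2
  field_simp

/-- The Gaussian factor legitimizes Fubini, and the right side is visibly real and nonnegative; both
properties pass to the inverse Fourier integral as `b → 0`. -/
lemma integral_charFun_mul_gaussian (P : Measure ℝ) [IsFiniteMeasure P] {b : ℝ} (hb : 0 < b)
    (x : ℝ) :
    ∫ z : ℝ, (Real.exp (-b * z ^ 2) : ℂ) * (Complex.exp (-(Complex.I * x * z)) * charFun P z) =
      ((∫ y, gaussKernel b (y - x) ∂P : ℝ) : ℂ) := by
  have hg : Integrable fun z : ℝ => (Real.exp (-b * z ^ 2) : ℂ) :=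
    (integrable_exp_neg_mul_sq hb).ofReal
  have hint : Integrable (Function.uncurry fun (z y : ℝ) =>
      Complex.exp (Complex.I * (y - x : ℝ) * z) * (Real.exp (-b * z ^ 2) : ℂ))
      (volume.prod P) := by
    refine (hg.norm.mul_prod (integrable_const (1 : ℝ))).mono' (by fun_prop)
      (Eventually.of_forall fun p => ?_)
    simp only [Function.uncurry]
    rw [norm_mul, norm_exp_I_mul_mul]
    simp
  calc _ = ∫ z : ℝ, ∫ y : ℝ, Complex.exp (Complex.I * (y - x : ℝ) * z) *
        (Real.exp (-b * z ^ 2) : ℂ) ∂P := by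
        congr with z
        rw [integral_mul_const, mul_comm, charFun_eq_integral_exp_I_mul, ← integral_const_mul]
        congr 2 with y
        rw [← Complex.exp_add]
        congr 1
        push_cast; ring
    _ = ∫ y : ℝ, (∫ z : ℝ, Complex.exp (Complex.I * (y - x : ℝ) * z) *
        (Real.exp (-b * z ^ 2) : ℂ)) ∂P := integral_integral_swap hint
    _ = _ := by
        simp_rw [integral_exp_mul_gaussian hb]
        rw [integral_complex_ofReal]

/-- The inverse Fourier integral of a characteristic function. -/
def invFourier (θ : ℝ → ℂ) (x : ℝ) : ℂ := ∫ z : ℝ, Complex.exp (-(Complex.I * x * z)) * θ z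

/-- The density attached to an integrable characteristic function. -/
def invDensity (θ : ℝ → ℂ) (x : ℝ) : ℝ := (2 * Real.pi)⁻¹ * (invFourier θ x).re

lemma norm_exp_neg_I_mul_mul (x z : ℝ) : ‖Complex.exp (-(Complex.I * x * z))‖ = 1 := by
  rw [Complex.norm_exp]; simp

lemma integrable_exp_mul {θ : ℝ → ℂ} (hθ : Integrable θ) (x : ℝ) :
    Integrable fun z : ℝ => Complex.exp (-(Complex.I * x * z)) * θ z :=
  hθ.norm.mono' (Continuous.aestronglyMeasurable (by fun_prop) |>.mul hθ.1)
    (Eventually.of_forall fun z => by rw [norm_mul, norm_exp_neg_I_mul_mul, one_mul])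

lemma continuous_invFourier {θ : ℝ → ℂ} (hθ : Integrable θ) : Continuous (invFourier θ) := by
  unfold invFourier
  refine continuous_of_dominated (bound := fun z => ‖θ z‖) (fun x => (integrable_exp_mul hθ x).1)
    (fun x => Eventually.of_forall fun z => ?_) hθ.norm (Eventually.of_forall fun z => by fun_prop)
  rw [norm_mul, norm_exp_neg_I_mul_mul, one_mul]

lemma continuous_invDensity {θ : ℝ → ℂ} (hθ : Integrable θ) : Continuous (invDensity θ) :=
  continuous_const.mul (Complex.continuous_re.comp (continuous_invFourier hθ))

lemma abs_invDensity_sub_le {θ θ' : ℝ → ℂ} (hθ : Integrable θ) (hθ' : Integrable θ') (x : ℝ) :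
    |invDensity θ x - invDensity θ' x| ≤ ∫ z, ‖θ z - θ' z‖ := by
  have h2 : (2 * Real.pi)⁻¹ ≤ 1 := inv_le_one_of_one_le₀ (by linarith [Real.pi_gt_three])
  have h3 : ‖invFourier θ x - invFourier θ' x‖ ≤ ∫ z, ‖θ z - θ' z‖ := by
    rw [invFourier, invFourier, ← integral_sub (integrable_exp_mul hθ x) (integrable_exp_mul hθ' x)]
    refine (norm_integral_le_integral_norm _).trans_eq ?_
    congr with z
    rw [← mul_sub, norm_mul, norm_exp_neg_I_mul_mul, one_mul]
  rw [invDensity, invDensity, ← mul_sub, ← Complex.sub_re, abs_mul,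
    abs_of_pos (by positivity : 0 < (2 * Real.pi)⁻¹)]
  refine (mul_le_of_le_one_left (abs_nonneg _) h2).trans ((Complex.abs_re_le_norm _).trans h3)

section Inversion

variable {P : Measure ℝ} [IsProbabilityMeasure P]

lemma tendsto_integral_gaussKernel (hθ : Integrable (charFun P)) (x : ℝ) :
    Tendsto (fun n : ℕ => ((∫ y, gaussKernel ((n : ℝ) + 1)⁻¹ (y - x) ∂P : ℝ) : ℂ)) atTop
      (𝓝 (invFourier (charFun P) x)) := by
  have h := (Real.tendsto_integral_cexp_sq_smul (integrable_exp_mul hθ x)).comp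
    (tendsto_atTop_add_const_right _ 1 tendsto_natCast_atTop_atTop)
  refine h.congr fun n => ?_
  rw [← integral_charFun_mul_gaussian P (by positivity)]
  simp only [Function.comp, smul_eq_mul]
  congr with z
  congr 1
  push_cast
  congr 2
  rw [← Complex.ofReal_pow, Real.norm_eq_abs, sq_abs, Complex.ofReal_pow]

lemma invFourier_charFun_eq (hθ : Integrable (charFun P)) (x : ℝ) :
    0 ≤ invDensity (charFun P) x ∧
      invFourier (charFun P) x = ((2 * Real.pi * invDensity (charFun P) x : ℝ) : ℂ) := by
  have h := tendsto_integral_gaussKernel hθ x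
  have hre := (Complex.continuous_re.tendsto _).comp h
  have him := (Complex.continuous_im.tendsto _).comp h
  simp only [Function.comp_def, Complex.ofReal_re, Complex.ofReal_im] at hre him
  have h0 : 0 ≤ (invFourier (charFun P) x).re :=
    ge_of_tendsto' hre fun n => integral_nonneg fun y => gaussKernel_nonneg _ _
  have h1 : (invFourier (charFun P) x).im = 0 := tendsto_nhds_unique him tendsto_const_nhds
  refine ⟨by unfold invDensity; positivity, ?_⟩
  have hpi := Real.pi_pos
  apply Complex.ext
  · rw [Complex.ofReal_re, invDensity]
    field_simp
  · rw [h1, Complex.ofReal_im]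

/-- Fatou's lemma: each regularization has total mass `1`. Only the inequality is needed, as it
gives integrability; equality comes with the identification of the law. -/
lemma lintegral_invDensity_le (hθ : Integrable (charFun P)) :
    ∫⁻ x, ENNReal.ofReal (invDensity (charFun P) x) ≤ 1 := by
  let c : ℝ := (2 * Real.pi)⁻¹
  have hc : 0 ≤ c := by positivity
  let F : ℕ → ℝ → ENNReal := fun n x =>
    ∫⁻ y, ENNReal.ofReal (c * gaussKernel ((n : ℝ) + 1)⁻¹ (y - x)) ∂P
  have hFm : ∀ n, Measurable (F n) := fun n =>
    Measurable.lintegral_prod_left' (f := fun p : ℝ × ℝ =>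
      ENNReal.ofReal (c * gaussKernel ((n : ℝ) + 1)⁻¹ (p.1 - p.2))) (by fun_prop)
  have hlim : ∀ x, Tendsto (fun n => F n x) atTop
      (𝓝 (ENNReal.ofReal (invDensity (charFun P) x))) := by
    intro x
    have h := ((Complex.continuous_re.tendsto _).comp (tendsto_integral_gaussKernel hθ x)).const_mul c
    simp only [Function.comp_def, Complex.ofReal_re] at h
    refine (ENNReal.tendsto_ofReal h).congr fun n => ?_
    rw [← integral_const_mul]
    refine ofReal_integral_eq_lintegral_ofReal ?_
      (Eventually.of_forall fun y => mul_nonneg hc (gaussKernel_nonneg _ _))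
    refine Integrable.const_mul ?_ _
    refine (integrable_const (√(Real.pi / ((n : ℝ) + 1)⁻¹))).mono' (by fun_prop)
      (Eventually.of_forall fun y => ?_)
    rw [Real.norm_of_nonneg (gaussKernel_nonneg _ _), gaussKernel]
    refine mul_le_of_le_one_right (Real.sqrt_nonneg _) (Real.exp_le_one_iff.2 ?_)
    rw [neg_mul, neg_nonpos]
    positivity
  have hmass : ∀ n, ∫⁻ x, F n x = 1 := by
    intro n
    rw [lintegral_lintegral_swap (by fun_prop)]
    have : ∀ y : ℝ, ∫⁻ x, ENNReal.ofReal (c * gaussKernel ((n : ℝ) + 1)⁻¹ (y - x)) = 1 := by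
      intro y
      rw [lintegral_sub_left_eq_self (fun s => ENNReal.ofReal (c * gaussKernel ((n : ℝ) + 1)⁻¹ s))]
      simp_rw [ENNReal.ofReal_mul hc]
      rw [lintegral_const_mul _ (by fun_prop), lintegral_gaussKernel (by positivity),
        ← ENNReal.ofReal_mul hc, inv_mul_cancel₀ (by positivity), ENNReal.ofReal_one]
    simp [this]
  calc ∫⁻ x, ENNReal.ofReal (invDensity (charFun P) x)
      = ∫⁻ x, liminf (fun n => F n x) atTop := by
        congr with x; exact (hlim x).liminf_eq.symm
    _ ≤ liminf (fun n => ∫⁻ x, F n x) atTop := lintegral_liminf_le hFm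
    _ = 1 := by simp [hmass]

open FourierTransform in
-- Inversion is applied to the characteristic function, not to the density: it is continuous and
-- integrable, and its Fourier transform is a rescaled `invDensity`, already known to be integrable.
lemma integral_exp_mul_invDensity (hθ : Integrable (charFun P)) (t : ℝ) :
    ∫ x : ℝ, Complex.exp (Complex.I * t * x) * (invDensity (charFun P) x : ℂ) = charFun P t := by
  have hpint : Integrable (invDensity (charFun P)) := by
    refine ⟨(continuous_invDensity hθ).aestronglyMeasurable, ?_⟩
    rw [hasFiniteIntegral_iff_ofReal (Eventually.of_forall fun x => (invFourier_charFun_eq hθ x).1)]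
    exact (lintegral_invDensity_le hθ).trans_lt ENNReal.one_lt_top
  have hpi := Real.pi_pos
  have hF : ∀ w, 𝓕 (charFun P) w =
      ((2 * Real.pi * invDensity (charFun P) (2 * Real.pi * w) : ℝ) : ℂ) := by
    intro w
    rw [← (invFourier_charFun_eq hθ _).2, Real.fourier_real_eq_integral_exp_smul, invFourier]
    congr with v
    rw [smul_eq_mul]
    congr 2
    push_cast; ring
  have hFint : Integrable (𝓕 (charFun P)) := by
    have : 𝓕 (charFun P) = fun w =>
      ((2 * Real.pi * invDensity (charFun P) (2 * Real.pi * w) : ℝ) : ℂ) := funext hF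
    rw [this]
    exact ((hpint.comp_mul_left' (by positivity : 2 * Real.pi ≠ 0)).const_mul _).ofReal
  have h := congrFun (Continuous.fourierInv_fourier_eq continuous_charFun hθ hFint) t
  rw [Real.fourierInv_eq'] at h
  rw [← h]
  have hsub := Measure.integral_comp_mul_left
    (fun x : ℝ => Complex.exp (Complex.I * t * x) * (invDensity (charFun P) x : ℂ)) (2 * Real.pi)
  rw [abs_of_pos (by positivity), eq_inv_smul_iff₀ (by positivity)] at hsub
  rw [← hsub, ← integral_smul]
  congr with w
  rw [hF, smul_eq_mul, Complex.real_smul]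
  have : Complex.exp (Complex.I * t * ((2 * Real.pi * w : ℝ) : ℂ)) =
      Complex.exp (((2 * Real.pi * inner ℝ w t : ℝ) : ℂ) * Complex.I) := by
    congr 1
    simp only [RCLike.inner_apply, conj_trivial]
    push_cast; ring
  rw [this]
  push_cast; ring

theorem isDensity_invDensity (hθ : Integrable (charFun P)) :
    IsDensity P (invDensity (charFun P)) := by
  refine ⟨(continuous_invDensity hθ).measurable, fun x => (invFourier_charFun_eq hθ x).1, ?_⟩
  have hm := (continuous_invDensity hθ).measurable
  set Q := volume.withDensity fun x => ENNReal.ofReal (invDensity (charFun P) x) with hQ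
  have : IsFiniteMeasure Q :=
    isFiniteMeasure_withDensity ((lintegral_invDensity_le hθ).trans_lt ENNReal.one_lt_top).ne
  refine Measure.ext_of_charFun ?_
  ext t
  rw [charFun_eq_integral_exp_I_mul Q, hQ, integral_withDensity_eq_integral_toReal_smul
    (by fun_prop) (Eventually.of_forall fun u => ENNReal.ofReal_lt_top),
    ← integral_exp_mul_invDensity hθ]
  congr with x
  rw [ENNReal.toReal_ofReal (invFourier_charFun_eq hθ x).1, Complex.real_smul, mul_comm]

end Inversion

/-! ### Square integrability of characteristic functions -/

/-- One half of Plancherel. `|θ|²` is the characteristic function of the difference of two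
independent copies, so its Gaussian-weighted integral is `∬ g(x) g(y) K(x - y)` with `∫ K = 2π`. Use
`g(x) g(y) ≤ (g(x)² + g(y)²) / 2`, then let the weight tend to `1` by Fatou. -/
theorem lintegral_norm_charFun_sq_le {P : Measure ℝ} [IsProbabilityMeasure P] {g : ℝ → ℝ}
    (hg : IsDensity P g) :
    ∫⁻ z, ENNReal.ofReal (‖charFun P z‖ ^ 2) ≤
      ENNReal.ofReal (2 * Real.pi) * ∫⁻ x, ENNReal.ofReal (g x ^ 2) := by
  have hgm := hg.measurable
  set Q := P.conv (P.map (fun x => (-1) * x)) with hQ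
  have : IsProbabilityMeasure (P.map fun x : ℝ => (-1) * x) :=
    Measure.isProbabilityMeasure_map (by fun_prop)
  have hQc : ∀ z, charFun Q z = ((‖charFun P z‖ ^ 2 : ℝ) : ℂ) := by
    intro z
    rw [hQ, charFun_conv, charFun_map_mul, neg_one_mul, charFun_neg, Complex.mul_conj,
      Complex.normSq_eq_norm_sq]
  have hsq : Measurable fun z => ‖charFun P z‖ ^ 2 := by fun_prop
  have key : ∀ b : ℝ, 0 < b →
      ∫⁻ z, ENNReal.ofReal (Real.exp (-b * z ^ 2) * ‖charFun P z‖ ^ 2) ≤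
        ENNReal.ofReal (2 * Real.pi) * ∫⁻ x, ENNReal.ofReal (g x ^ 2) := by
    intro b hb
    have h1 := integral_charFun_mul_gaussian Q hb 0
    simp only [hQc, Complex.ofReal_zero, mul_zero, zero_mul, neg_zero, Complex.exp_zero, one_mul,
      sub_zero] at h1
    simp only [← Complex.ofReal_mul] at h1
    rw [integral_complex_ofReal, Complex.ofReal_inj] at h1
    have hi1 : Integrable fun z => Real.exp (-b * z ^ 2) * ‖charFun P z‖ ^ 2 := by
      refine (integrable_exp_neg_mul_sq hb).mono' (by fun_prop) (Eventually.of_forall fun z => ?_)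
      rw [Real.norm_of_nonneg (by positivity)]
      exact mul_le_of_le_one_right (by positivity)
        (pow_le_one₀ (norm_nonneg _) (norm_charFun_le_one z))
    have hi2 : Integrable (gaussKernel b) Q := by
      refine (integrable_const (√(Real.pi / b))).mono' (by fun_prop)
        (Eventually.of_forall fun y => ?_)
      rw [Real.norm_of_nonneg (gaussKernel_nonneg _ _), gaussKernel]
      refine mul_le_of_le_one_right (Real.sqrt_nonneg _) (Real.exp_le_one_iff.2 ?_)
      rw [neg_mul, neg_nonpos]
      positivity
    rw [← ofReal_integral_eq_lintegral_ofReal hi1 (Eventually.of_forall fun z => by positivity), h1,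
      ofReal_integral_eq_lintegral_ofReal hi2 (Eventually.of_forall (gaussKernel_nonneg b)), hQ,
      Measure.lintegral_conv (by fun_prop)]
    have h2 : ∀ x : ℝ, ∫⁻ y, ENNReal.ofReal (gaussKernel b (x + y)) ∂(P.map fun x => (-1) * x) =
        ∫⁻ y, ENNReal.ofReal (gaussKernel b (x - y)) ∂P := by
      intro x
      rw [lintegral_map (by fun_prop) (by fun_prop)]
      congr with y
      rw [neg_one_mul, ← sub_eq_add_neg]
    simp_rw [h2]
    rw [hg.eq_withDensity]
    have hd : Measurable fun x => ENNReal.ofReal (g x) := by fun_prop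
    have hin : ∀ x : ℝ, ∫⁻ y, ENNReal.ofReal (gaussKernel b (x - y))
        ∂(volume.withDensity fun x => ENNReal.ofReal (g x)) =
        ∫⁻ y, ENNReal.ofReal (g y) * ENNReal.ofReal (gaussKernel b (x - y)) := fun x =>
      lintegral_withDensity_eq_lintegral_mul _ hd (by fun_prop)
    simp_rw [hin]
    rw [lintegral_withDensity_eq_lintegral_mul _ hd
      (Measurable.lintegral_prod_right' (f := fun p : ℝ × ℝ =>
        ENNReal.ofReal (g p.2) * ENNReal.ofReal (gaussKernel b (p.1 - p.2))) (by fun_prop))]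
    simp only [Pi.mul_apply]
    have hK : ∀ x : ℝ, ∫⁻ y, ENNReal.ofReal (gaussKernel b (x - y)) =
        ENNReal.ofReal (2 * Real.pi) := fun x => by
      rw [lintegral_sub_left_eq_self (fun s => ENNReal.ofReal (gaussKernel b s)),
        lintegral_gaussKernel hb]
    have hK' : ∀ y : ℝ, ∫⁻ x, ENNReal.ofReal (gaussKernel b (x - y)) =
        ENNReal.ofReal (2 * Real.pi) := fun y => by
      rw [lintegral_sub_right_eq_self (fun s => ENNReal.ofReal (gaussKernel b s)),
        lintegral_gaussKernel hb]
    calc ∫⁻ x, ENNReal.ofReal (g x) *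
          ∫⁻ y, ENNReal.ofReal (g y) * ENNReal.ofReal (gaussKernel b (x - y))
        ≤ ∫⁻ x, ∫⁻ y, (ENNReal.ofReal (2⁻¹ * g x ^ 2) * ENNReal.ofReal (gaussKernel b (x - y)) +
          ENNReal.ofReal (2⁻¹ * g y ^ 2) * ENNReal.ofReal (gaussKernel b (x - y))) := by
          refine lintegral_mono fun x => ?_
          rw [← lintegral_const_mul _ (by fun_prop)]
          refine lintegral_mono fun y => ?_
          dsimp only
          rw [← mul_assoc, ← add_mul, ← ENNReal.ofReal_mul (hg.nonneg x),
            ← ENNReal.ofReal_add (by positivity) (by positivity)]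
          gcongr
          nlinarith [sq_nonneg (g x - g y)]
      _ = (∫⁻ x, ∫⁻ y, ENNReal.ofReal (2⁻¹ * g x ^ 2) * ENNReal.ofReal (gaussKernel b (x - y))) +
          ∫⁻ x, ∫⁻ y, ENNReal.ofReal (2⁻¹ * g y ^ 2) * ENNReal.ofReal (gaussKernel b (x - y)) := by
          rw [← lintegral_add_left (Measurable.lintegral_prod_right' (f := fun p : ℝ × ℝ =>
            ENNReal.ofReal (2⁻¹ * g p.1 ^ 2) * ENNReal.ofReal (gaussKernel b (p.1 - p.2)))
            (by fun_prop))]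
          congr with x
          rw [lintegral_add_left (by fun_prop)]
      _ = (∫⁻ x, ENNReal.ofReal (2⁻¹ * g x ^ 2) * ENNReal.ofReal (2 * Real.pi)) +
          ∫⁻ y, ENNReal.ofReal (2⁻¹ * g y ^ 2) * ENNReal.ofReal (2 * Real.pi) := by
          congr 1
          · congr with x
            rw [lintegral_const_mul _ (by fun_prop), hK]
          · rw [lintegral_lintegral_swap (by fun_prop)]
            congr with y
            rw [lintegral_const_mul _ (by fun_prop), hK']
      _ = _ := by
          have : ∀ x, ENNReal.ofReal (2⁻¹ * g x ^ 2) = 2⁻¹ * ENNReal.ofReal (g x ^ 2) := fun x => by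
            rw [ENNReal.ofReal_mul (by positivity), ENNReal.ofReal_inv_of_pos (by positivity),
              ENNReal.ofReal_ofNat]
          simp_rw [this]
          rw [lintegral_mul_const _ (by fun_prop), lintegral_const_mul _ (by fun_prop), ← add_mul,
            ← add_mul, ENNReal.inv_two_add_inv_two, one_mul, mul_comm]
  let F : ℕ → ℝ → ENNReal := fun n z =>
    ENNReal.ofReal (Real.exp (-((n : ℝ) + 1)⁻¹ * z ^ 2) * ‖charFun P z‖ ^ 2)
  have hlim : ∀ z, Tendsto (fun n => F n z) atTop (𝓝 (ENNReal.ofReal (‖charFun P z‖ ^ 2))) := by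
    intro z
    refine ENNReal.tendsto_ofReal ?_
    have h1 : Tendsto (fun n : ℕ => ((n : ℝ) + 1)⁻¹) atTop (𝓝 0) := by
      simpa using tendsto_one_div_add_atTop_nhds_zero_nat (𝕜 := ℝ)
    have h2 : Tendsto (fun n : ℕ => Real.exp (-((n : ℝ) + 1)⁻¹ * z ^ 2)) atTop (𝓝 1) := by
      rw [← Real.exp_zero]
      refine (Real.continuous_exp.tendsto 0).comp ?_
      simpa using h1.neg.mul_const (z ^ 2)
    simpa using h2.mul_const (‖charFun P z‖ ^ 2)
  calc ∫⁻ z, ENNReal.ofReal (‖charFun P z‖ ^ 2) = ∫⁻ z, liminf (fun n => F n z) atTop := by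
        congr with z; exact (hlim z).liminf_eq.symm
    _ ≤ liminf (fun n => ∫⁻ z, F n z) atTop :=
        lintegral_liminf_le fun n => by fun_prop
    _ ≤ _ := liminf_le_of_le (by isBoundedDefault) fun c hc => by
        obtain ⟨n, hn⟩ := hc.exists
        exact hn.trans (key _ (by positivity))

/-! ### Inequalities for characteristic functions -/

lemma norm_exp_natCast_mul_sub_le (x η : ℝ) (k : ℕ) :
    ‖Complex.exp (Complex.I * (k * x : ℝ)) - Complex.exp (Complex.I * (k * η : ℝ))‖ ≤
      k * ‖Complex.exp (Complex.I * x) - Complex.exp (Complex.I * η)‖ := by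
  have e : ∀ s : ℝ, Complex.exp (Complex.I * (k * s : ℝ)) = Complex.exp (Complex.I * s) ^ k := by
    intro s
    rw [← Complex.exp_nat_mul]
    congr 1
    push_cast; ring
  rw [e, e]
  rcases k with _ | k
  · simp
  · have h := norm_pow_sub_pow_le_of_norm_le (R := 1) (x := Complex.exp (Complex.I * x))
      (y := Complex.exp (Complex.I * η)) (by rw [Complex.norm_exp_I_mul_ofReal])
      (by rw [Complex.norm_exp_I_mul_ofReal]) k
    rwa [one_pow, mul_one] at h

lemma norm_exp_I_mul_sub_sq (x η : ℝ) :
    ‖Complex.exp (Complex.I * x) - Complex.exp (Complex.I * η)‖ ^ 2 =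
      2 - 2 * (Complex.exp (Complex.I * x) * Complex.exp (-(Complex.I * η))).re := by
  have h1 := Complex.exp_ofReal_mul_I_re
  have h2 := Complex.exp_ofReal_mul_I_im
  rw [← Complex.exp_add, ← Complex.normSq_eq_norm_sq, Complex.normSq_apply]
  have e : Complex.I * x + -(Complex.I * η) = ((x - η : ℝ) : ℂ) * Complex.I := by push_cast; ring
  rw [e, h1, mul_comm Complex.I, mul_comm Complex.I, Complex.sub_re, Complex.sub_im, h1, h1, h2, h2,
    Real.cos_sub]
  nlinarith [Real.sin_sq_add_cos_sq x, Real.sin_sq_add_cos_sq η]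

section CharFun

variable {P : Measure ℝ}

lemma charFun_eq_integral_exp_I_ofReal_mul (z : ℝ) :
    charFun P z = ∫ u : ℝ, Complex.exp (Complex.I * (z * u : ℝ)) ∂P := by
  rw [charFun_eq_integral_exp_I_mul]
  congr with u
  push_cast
  ring_nf

lemma norm_charFun_le_exp_of_mul_le {c : ℝ} {z : ℝ}
    (h : c * (1 - (charFun P z).re) ≤ 1 - ‖charFun P z‖) :
    ‖charFun P z‖ ≤ Real.exp (-(c * (1 - (charFun P z).re))) := by
  have := Real.add_one_le_exp (-(c * (1 - (charFun P z).re)))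
  linarith

variable [IsProbabilityMeasure P]

/-- If `θ(z) = r e^{iη}`, then `θ(kz)` is close to `e^{ikη}` when `r` is close to `1`. -/
lemma norm_charFun_natCast_mul_sub_le {z η r : ℝ}
    (hr : charFun P z = r * Complex.exp (Complex.I * η)) (k : ℕ) :
    ‖charFun P (k * z) - Complex.exp (Complex.I * (k * η : ℝ))‖ ≤ k * √(2 * (1 - r)) := by
  set f : ℝ → ℝ := fun u =>
    ‖Complex.exp (Complex.I * (z * u : ℝ)) - Complex.exp (Complex.I * η)‖ with hf
  have hfc : Continuous f := by fun_prop
  have hfb : ∀ u, ‖f u‖ ≤ 2 := by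
    intro u
    rw [hf, norm_norm]
    refine (norm_sub_le _ _).trans_eq ?_
    rw [Complex.norm_exp_I_mul_ofReal, Complex.norm_exp_I_mul_ofReal]
    norm_num
  have hfi : Integrable f P :=
    (integrable_const (2 : ℝ)).mono' (by fun_prop) (Eventually.of_forall hfb)
  have hfi2 : Integrable (fun u => f u ^ 2) P :=
    (integrable_const (2 ^ 2 : ℝ)).mono' (by fun_prop) (Eventually.of_forall fun u => by
      rw [norm_pow]; exact pow_le_pow_left₀ (norm_nonneg _) (hfb u) 2)
  have hexp : ∀ w : ℝ, Integrable (fun u : ℝ => Complex.exp (Complex.I * (w * u : ℝ))) P := by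
    intro w
    refine (integrable_const (1 : ℝ)).mono' (by fun_prop) (Eventually.of_forall fun u => ?_)
    rw [Complex.norm_exp_I_mul_ofReal]
  -- Rotating by `e^{-iη}` turns the mean of `e^{izu}` into the real number `r`.
  have hsq : ∫ u, f u ^ 2 ∂P = 2 * (1 - r) := by
    have h1 : ∀ u, f u ^ 2 =
        2 - 2 * (Complex.exp (Complex.I * (z * u : ℝ)) * Complex.exp (-(Complex.I * η))).re :=
      fun u => norm_exp_I_mul_sub_sq _ _
    have hi : Integrable (fun u : ℝ =>
        Complex.exp (Complex.I * (z * u : ℝ)) * Complex.exp (-(Complex.I * η))) P :=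
      (hexp z).mul_const _
    have h2 : ∫ u : ℝ, (Complex.exp (Complex.I * (z * u : ℝ)) *
        Complex.exp (-(Complex.I * η))).re ∂P = r := by
      have h3 := Complex.reCLM.integral_comp_comm hi
      simp only [Complex.reCLM_apply] at h3
      rw [h3, integral_mul_const, ← charFun_eq_integral_exp_I_ofReal_mul, hr, mul_assoc,
        ← Complex.exp_add, add_neg_cancel, Complex.exp_zero, mul_one, Complex.ofReal_re]
    have hi' : Integrable (fun u : ℝ => 2 * (Complex.exp (Complex.I * (z * u : ℝ)) *
        Complex.exp (-(Complex.I * η))).re) P := (Complex.reCLM.integrable_comp hi).const_mul 2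
    simp_rw [h1]
    rw [integral_sub (integrable_const _) hi', integral_const_mul, h2]
    simp
    ring
  -- Cauchy–Schwarz, in the form that the variance of `f` is nonnegative.
  have hmean : ∫ u, f u ∂P ≤ √(2 * (1 - r)) := by
    refine Real.le_sqrt_of_sq_le ?_
    rw [← hsq]
    set e := ∫ u, f u ∂P with he
    have h0 : 0 ≤ ∫ u, (f u - e) ^ 2 ∂P := integral_nonneg fun u => sq_nonneg _
    have h1 : ∫ u, (f u - e) ^ 2 ∂P = ∫ u, f u ^ 2 ∂P - e ^ 2 := by
      have : ∀ u, (f u - e) ^ 2 = f u ^ 2 - (2 * e * f u - e ^ 2) := fun u => by ring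
      simp_rw [this]
      have hi : Integrable (fun u => 2 * e * f u) P := hfi.const_mul _
      have hi' : Integrable (fun u => 2 * e * f u - e ^ 2) P := hi.sub (integrable_const _)
      rw [integral_sub hfi2 hi', integral_sub hi (integrable_const _), integral_const_mul, ← he]
      simp
      ring
    linarith
  have hdiff : charFun P (k * z) - Complex.exp (Complex.I * (k * η : ℝ)) =
      ∫ u : ℝ, (Complex.exp (Complex.I * ((k * z : ℝ) * u : ℝ)) -
        Complex.exp (Complex.I * (k * η : ℝ))) ∂P := by
    rw [integral_sub (hexp _) (integrable_const _), ← charFun_eq_integral_exp_I_ofReal_mul]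
    simp
  rw [hdiff]
  calc _ ≤ ∫ u, k * f u ∂P := by
        refine norm_integral_le_of_norm_le (hfi.const_mul _) (Eventually.of_forall fun u => ?_)
        have := norm_exp_natCast_mul_sub_le (z * u) η k
        rwa [← mul_assoc] at this
    _ = k * ∫ u, f u ∂P := integral_const_mul _ _
    _ ≤ _ := by gcongr

/-- Integrate `1 - cos(ku) ≤ k² (1 - cos u)`, which is the squared chord inequality `|e^{iku} - 1| ≤
k |e^{iu} - 1|`. -/
lemma one_sub_re_charFun_natCast_mul_le (z : ℝ) (k : ℕ) :
    1 - (charFun P (k * z)).re ≤ k ^ 2 * (1 - (charFun P z).re) := by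
  have hexp : ∀ w : ℝ, Integrable (fun u : ℝ => Complex.exp (Complex.I * (w * u : ℝ))) P := by
    intro w
    refine (integrable_const (1 : ℝ)).mono' (by fun_prop) (Eventually.of_forall fun u => ?_)
    rw [Complex.norm_exp_I_mul_ofReal]
  have hsq : ∀ u : ℝ, ‖Complex.exp (Complex.I * u) - Complex.exp (Complex.I * (0 : ℝ))‖ ^ 2 =
      2 - 2 * (Complex.exp (Complex.I * u)).re := by
    intro u
    rw [norm_exp_I_mul_sub_sq]
    simp
  have hre : ∀ w : ℝ, 1 - (charFun P w).re =
      ∫ u : ℝ, (1 - (Complex.exp (Complex.I * (w * u : ℝ))).re) ∂P := by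
    intro w
    have h3 := Complex.reCLM.integral_comp_comm (hexp w)
    simp only [Complex.reCLM_apply] at h3
    have hi : Integrable (fun u : ℝ => (Complex.exp (Complex.I * (w * u : ℝ))).re) P :=
      Complex.reCLM.integrable_comp (hexp w)
    rw [integral_sub (integrable_const _) hi, charFun_eq_integral_exp_I_ofReal_mul, h3]
    simp
  have hint : ∀ w : ℝ,
      Integrable (fun u : ℝ => 1 - (Complex.exp (Complex.I * (w * u : ℝ))).re) P := fun w =>
    (integrable_const _).sub (Complex.reCLM.integrable_comp (hexp w))
  rw [hre, hre, ← integral_const_mul]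
  refine integral_mono (hint _) ((hint z).const_mul _) fun u => ?_
  have h := norm_exp_natCast_mul_sub_le (z * u) 0 k
  have h2 := pow_le_pow_left₀ (norm_nonneg _) h 2
  rw [mul_zero, mul_pow, hsq, hsq, ← mul_assoc] at h2
  dsimp only
  linarith

/-- If `Re θ` is bounded below on `[-δ, δ]` and `|θ|` is bounded away from `1` near `±δ`, then on
`[-δ, δ]` the distances of `|θ|` and of `Re θ` to `1` are comparable. -/
theorem mul_one_sub_re_charFun_le {δ m q : ℝ} (hm : 0 < m) (hq : q < 1)
    (hre : ∀ z, |z| ≤ δ → m ≤ (charFun P z).re) (hnorm : ∀ z, δ / 2 ≤ |z| → ‖charFun P z‖ ≤ q)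
    {z : ℝ} (hz : |z| ≤ δ) :
    (1 + ((min m (1 - q) / 4) ^ 2)⁻¹)⁻¹ * (1 - (charFun P z).re) ≤ 1 - ‖charFun P z‖ := by
  -- As `π < 4`, an error of `ρ π` is smaller than both `m` and `1 - q`.
  set ρ := min m (1 - q) / 4 with hρ
  have hρ0 : 0 < ρ := by
    have : 0 < min m (1 - q) := lt_min hm (by linarith)
    positivity
  have hρm : ρ * Real.pi < m := by
    have : min m (1 - q) ≤ m := min_le_left _ _
    rw [hρ]
    nlinarith [Real.pi_lt_four, Real.pi_pos]
  have hρq : ρ * Real.pi < 1 - q := by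
    have : min m (1 - q) ≤ 1 - q := min_le_right _ _
    rw [hρ]
    nlinarith [Real.pi_lt_four, Real.pi_pos]
  set r := ‖charFun P z‖ with hr
  set η := (charFun P z).arg with hη
  have hr1 : r ≤ 1 := norm_charFun_le_one z
  have hpol : charFun P z = r * Complex.exp (Complex.I * η) := by
    rw [mul_comm Complex.I]; exact (Complex.norm_mul_exp_arg_mul_I _).symm
  have hcos : (charFun P z).re = r * Real.cos η := by
    conv_lhs => rw [hpol]
    rw [mul_comm Complex.I, Complex.re_ofReal_mul, Complex.exp_ofReal_mul_I_re]
  have hη2 : |η| ≤ Real.pi / 2 := Complex.abs_arg_le_pi_div_two_iff.2 (hm.le.trans (hre z hz))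
  -- The argument of `θ(z)` is controlled by its modulus. Otherwise `θ(kz)` stays within `ρ π` of
  -- `e^{ikη}` as long as `k |η| ≤ π`, and a suitable multiple of `z` contradicts one of the two
  -- assumptions.
  have key : ρ * |η| ≤ √(2 * (1 - r)) := by
    by_contra! hlt
    have hη0 : 0 < |η| := by
      by_contra! h
      have : |η| = 0 := le_antisymm h (abs_nonneg _)
      rw [this, mul_zero] at hlt
      exact absurd hlt (not_lt.2 (Real.sqrt_nonneg _))
    have hz0 : 0 < |z| := by
      rw [abs_pos]
      rintro rfl
      rw [hη, charFun_zero] at hη0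
      simp at hη0
    have happ : ∀ k : ℕ, (k : ℝ) * |η| ≤ Real.pi →
        ‖charFun P (k * z) - Complex.exp (Complex.I * (k * η : ℝ))‖ ≤ ρ * Real.pi := by
      intro k hk
      refine (norm_charFun_natCast_mul_sub_le hpol k).trans ?_
      calc (k : ℝ) * √(2 * (1 - r)) ≤ k * (ρ * |η|) := by gcongr
        _ = ρ * (k * |η|) := by ring
        _ ≤ ρ * Real.pi := by gcongr
    -- The last multiple of `z` inside `[-δ, δ]`; it lies in the outer half of the interval, where
    -- `|θ| ≤ q`.
    set K := ⌊δ / |z|⌋₊ with hK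
    have hδ : 0 < δ := hz0.trans_le hz
    have hK1 : (K : ℝ) * |z| ≤ δ := by
      rw [← le_div_iff₀ hz0]
      exact Nat.floor_le (by positivity)
    have hK2 : δ / 2 ≤ K * |z| := by
      have h1 : 1 ≤ K := by
        rw [hK, Nat.one_le_floor_iff, le_div_iff₀ hz0, one_mul]
        exact hz
      have h2 : δ < (K + 1) * |z| := by
        rw [← div_lt_iff₀ hz0]
        exact Nat.lt_floor_add_one _
      have h3 : (1 : ℝ) ≤ K := by exact_mod_cast h1
      nlinarith
    -- If the angle is still at most `π` at `K z`, then `|θ(Kz)| ≥ 1 - ρ π > q`. If not, an earlier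
    -- multiple has its angle in `[π/2, π]`, which forces `Re θ(kz) ≤ ρ π < m`.
    rcases le_or_gt ((K : ℝ) * |η|) Real.pi with hc | hc
    · have h1 := happ K hc
      have h2 := hnorm (K * z) (by rwa [abs_mul, Nat.abs_cast])
      have h3 := norm_sub_norm_le (Complex.exp (Complex.I * (K * η : ℝ))) (charFun P (K * z))
      rw [norm_sub_rev, Complex.norm_exp_I_mul_ofReal] at h3
      linarith
    · set k := ⌈Real.pi / (2 * |η|)⌉₊ with hk
      have hx1 : 1 ≤ Real.pi / (2 * |η|) := by
        rw [le_div_iff₀ (by positivity)]; linarith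
      have hk1 : Real.pi / (2 * |η|) ≤ k := Nat.le_ceil _
      have hk2 : (k : ℝ) < Real.pi / (2 * |η|) + 1 := Nat.ceil_lt_add_one (by positivity)
      have hk1' : Real.pi / 2 ≤ k * |η| := by
        rw [div_le_iff₀ (by positivity)] at hk1
        linarith
      have hk2' : (k : ℝ) * |η| ≤ Real.pi := by
        -- Rounding up at most doubles a number that is at least `1`; here `|η| ≤ π / 2` is used.
        have : (k : ℝ) ≤ 2 * (Real.pi / (2 * |η|)) := by linarith
        calc (k : ℝ) * |η| ≤ 2 * (Real.pi / (2 * |η|)) * |η| := by gcongr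
          _ = Real.pi := by field_simp
      have hkK : (k : ℝ) ≤ K := le_of_mul_le_mul_right (hk2'.trans hc.le) hη0
      have h1 := happ k hk2'
      have h2 := hre (k * z) (by
        rw [abs_mul, Nat.abs_cast]
        exact (mul_le_mul_of_nonneg_right hkK hz0.le).trans hK1)
      have h3 : (Complex.exp (Complex.I * (k * η : ℝ))).re ≤ 0 := by
        rw [mul_comm, Complex.exp_ofReal_mul_I_re, ← Real.cos_abs, abs_mul, Nat.abs_cast]
        exact Real.cos_nonpos_of_pi_div_two_le_of_le hk1' (by linarith [Real.pi_pos])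
      have h4 := (Complex.re_le_norm _).trans h1
      rw [Complex.sub_re] at h4
      linarith
  have hsq : (ρ * |η|) ^ 2 ≤ 2 * (1 - r) := by
    rw [← Real.sq_sqrt (by linarith : 0 ≤ 2 * (1 - r))]
    exact pow_le_pow_left₀ (by positivity) key 2
  rw [mul_pow, sq_abs] at hsq
  have hη' : η ^ 2 / 2 ≤ (ρ ^ 2)⁻¹ * (1 - r) := by
    rw [inv_mul_eq_div, le_div_iff₀ (by positivity)]
    linarith
  -- Now `1 - r cos η ≤ (1 - r) + η² / 2 ≤ (1 + ρ⁻²) (1 - r)`.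
  have hcosη := Real.one_sub_sq_div_two_le_cos (x := η)
  rw [inv_mul_le_iff₀ (by positivity), hcos]
  have hr0 : 0 ≤ r := norm_nonneg _
  nlinarith

/-- `Re θ` is continuous, equals `1` at the origin and never vanishes on the interval, so it cannot
change sign. -/
lemma le_re_charFun_of_le_abs {δ m : ℝ} (hm : 0 < m)
    (h : ∀ z, |z| ≤ δ → m ≤ |(charFun P z).re|) {z : ℝ} (hz : |z| ≤ δ) :
    m ≤ (charFun P z).re := by
  have h0 := h z hz
  rcases le_or_gt 0 (charFun P z).re with hpos | hneg
  · rwa [abs_of_nonneg hpos] at h0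
  exfalso
  have hc : ContinuousOn (fun t : ℝ => (charFun P (t * z)).re) (Set.Icc 0 1) :=
    (Complex.continuous_re.comp (continuous_charFun.comp (by fun_prop))).continuousOn
  have hiv := intermediate_value_Icc' (zero_le_one' ℝ) hc
  obtain ⟨t, ht, ht0⟩ := hiv (show (0 : ℝ) ∈ _ by
    simp only [one_mul, zero_mul, charFun_zero]
    exact ⟨hneg.le, by simp⟩)
  have h1 := h (t * z) (by
    rw [abs_mul, abs_of_nonneg ht.1]
    exact (mul_le_of_le_one_left (abs_nonneg _) ht.2).trans hz)
  dsimp only at ht0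
  rw [ht0, abs_zero] at h1
  linarith

end CharFun

/-! ### Elementary estimates -/

/-- A stretched exponential beats every power. The cube is what the final integration needs: two
powers of `1 + z²` absorb the error terms and one remains integrable. The variable `t` stands for a
multiple of `Re ψ` or of `Re ψ_n`. -/
lemma exists_exp_neg_le_div {c α : ℝ} (hc : 0 < c) (hα : 0 < α) (R : ℝ) :
    ∃ K : ℝ, 0 < K ∧ ∀ t z : ℝ, 0 ≤ t → (R ≤ |z| → c * |z| ^ α ≤ t) →
      Real.exp (-t) ≤ K / (1 + z ^ 2) ^ 3 := by
  -- The exponent is chosen so that `(|z|^α)^(6/α) = |z|^6 = (z²)³`.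
  have h := (tendsto_rpow_mul_exp_neg_mul_atTop_nhds_zero (6 / α) c hc).comp
    (tendsto_rpow_atTop hα)
  obtain ⟨X, hX⟩ := eventually_atTop.1 (h.eventually_le_const one_pos)
  set Y := max R (max X 1) with hY
  -- `8` comes from `1 + z² ≤ 2 z²` when `|z| ≥ 1`; the other summand covers `|z| < Y`.
  refine ⟨8 + (1 + Y ^ 2) ^ 3, by positivity, fun t z ht hz => ?_⟩
  rw [le_div_iff₀ (by positivity)]
  rcases le_or_gt Y |z| with hzY | hzY
  · have hR : R ≤ |z| := (le_max_left _ _).trans hzY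
    have hzX : X ≤ |z| := (le_max_left _ _).trans ((le_max_right _ _).trans hzY)
    have hz1 : 1 ≤ |z| := (le_max_right _ _).trans ((le_max_right _ _).trans hzY)
    have h1 := hX |z| hzX
    simp only [Function.comp] at h1
    rw [← Real.rpow_mul (abs_nonneg z), mul_div_cancel₀ _ hα.ne'] at h1
    have h6 : |z| ^ (6 : ℝ) = (z ^ 2) ^ 3 := by
      rw [show (6 : ℝ) = ((6 : ℕ) : ℝ) by norm_num, Real.rpow_natCast, ← sq_abs z]
      ring
    rw [h6] at h1
    have hz2 : 1 ≤ z ^ 2 := by rw [← sq_abs]; nlinarith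
    have h8 : (1 + z ^ 2) ^ 3 ≤ 8 * (z ^ 2) ^ 3 := by
      calc (1 + z ^ 2) ^ 3 ≤ (2 * z ^ 2) ^ 3 := by gcongr; linarith
        _ = 8 * (z ^ 2) ^ 3 := by ring
    have hexp : Real.exp (-t) ≤ Real.exp (-c * |z| ^ α) :=
      Real.exp_le_exp.2 (by linarith [hz hR])
    calc Real.exp (-t) * (1 + z ^ 2) ^ 3
        ≤ Real.exp (-c * |z| ^ α) * (8 * (z ^ 2) ^ 3) := by gcongr
      _ = 8 * ((z ^ 2) ^ 3 * Real.exp (-c * |z| ^ α)) := by ring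
      _ ≤ 8 * 1 := by gcongr
      _ ≤ _ := by linarith [show 0 ≤ (1 + Y ^ 2) ^ 3 by positivity]
  · have h1 : Real.exp (-t) ≤ 1 := Real.exp_le_one_iff.2 (by linarith)
    have h2 : (1 + z ^ 2) ^ 3 ≤ (1 + Y ^ 2) ^ 3 := by
      rw [← sq_abs z]; gcongr
    calc Real.exp (-t) * (1 + z ^ 2) ^ 3 ≤ 1 * (1 + Y ^ 2) ^ 3 := by gcongr
      _ ≤ _ := by linarith

/-- With `q = e^{-2l}`, eventually `b_n ≤ e^{l a_n}`, so `b_n q ^ a_n ≤ e^{-l a_n} ≤ 1 / a_n`. The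
two missing factors `q` cost `q⁻²`. -/
lemma eventually_mul_pow_le_div {a : ℕ → ℕ} {b : ℕ → ℝ} (ha : Tendsto a atTop atTop)
    (hb_pos : ∀ n, 0 < b n)
    (hab : Tendsto (fun n => Real.log (b n) / (a n : ℝ)) atTop (𝓝 0)) {q : ℝ} (hq0 : 0 < q)
    (hq1 : q < 1) : ∀ᶠ n in atTop, b n * q ^ (a n - 2) ≤ (q ^ 2)⁻¹ / a n := by
  set l := -Real.log q / 2 with hl
  have hl0 : 0 < l := by
    have := Real.log_neg hq0 hq1
    rw [hl]; linarith
  have haR : Tendsto (fun n => (a n : ℝ)) atTop atTop := tendsto_natCast_atTop_atTop.comp ha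
  have h1 := (tendsto_rpow_mul_exp_neg_mul_atTop_nhds_zero 1 l hl0).comp haR
  filter_upwards [h1.eventually_le_const one_pos, hab.eventually_le_const hl0,
    ha.eventually_ge_atTop 2] with n hn1 hn2 hn3
  have ha0 : (0 : ℝ) < a n := by exact_mod_cast (by omega : 0 < a n)
  simp only [Function.comp, Real.rpow_one] at hn1
  rw [div_le_iff₀ ha0, Real.log_le_iff_le_exp (hb_pos n)] at hn2
  have hqa : q ^ a n = Real.exp (-(2 * l) * a n) := by
    rw [hl, mul_comm, ← Real.rpow_natCast, Real.rpow_def_of_pos hq0]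
    ring_nf
  have hpow : q ^ (a n - 2) = q ^ a n * (q ^ 2)⁻¹ := pow_sub₀ q hq0.ne' hn3
  rw [le_div_iff₀ ha0, hpow, hqa]
  calc b n * (Real.exp (-(2 * l) * a n) * (q ^ 2)⁻¹) * a n
      ≤ Real.exp (l * a n) * (Real.exp (-(2 * l) * a n) * (q ^ 2)⁻¹) * a n := by gcongr
    _ = (q ^ 2)⁻¹ * (a n * Real.exp (-l * a n)) := by
        have : Real.exp (-l * a n) = Real.exp (l * a n) * Real.exp (-(2 * l) * a n) := by
          rw [← Real.exp_add]; ring_nf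
        rw [this]; ring
    _ ≤ (q ^ 2)⁻¹ * 1 := by gcongr
    _ = _ := mul_one _

lemma exp_neg_div_pow_pred_le {m : ℕ} (hm : 2 ≤ m) {x : ℝ} (hx : 0 ≤ x) :
    Real.exp (-(x / m)) ^ (m - 1) ≤ Real.exp (-(x / 2)) := by
  rw [← Real.exp_nat_mul]
  refine Real.exp_le_exp.2 ?_
  have hm0 : (0 : ℝ) < m := by exact_mod_cast (by omega : 0 < m)
  have hm2 : (2 : ℝ) ≤ m := by exact_mod_cast hm
  rw [Nat.cast_sub (by omega), Nat.cast_one, mul_neg, neg_le_neg_iff, mul_div_assoc',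
    div_le_div_iff₀ two_pos hm0]
  nlinarith

/-- Here `R` is the larger of the decays of `f` and of `e^{-w/m}`. Passing from `R ^ m` to `R ^ (m -
1)` at most halves the exponents, since `m - 1 ≥ m / 2`. -/
lemma norm_pow_sub_exp_neg_le_of_norm_le_exp {f w : ℂ} {m : ℕ} {c : ℝ} (hm : 2 ≤ m)
    (hc : 0 ≤ c) (hf1 : f.re ≤ 1) (hw : 0 ≤ w.re) (hf : ‖f‖ ≤ Real.exp (-(c * (1 - f.re)))) :
    ‖f ^ m - Complex.exp (-w)‖ ≤
      (Real.exp (-(c * (m * (1 - f.re)) / 2)) + Real.exp (-(w.re / 2))) *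
        (‖(m : ℂ) * (1 - f) - w‖ + 3 * ‖w‖ ^ 2 / m) := by
  have hm0 : (m : ℝ) ≠ 0 := by exact_mod_cast (by omega : m ≠ 0)
  set t := c * (m * (1 - f.re)) with ht
  have ht0 : 0 ≤ t := mul_nonneg hc (mul_nonneg (by positivity) (by linarith))
  have hft : ‖f‖ ≤ Real.exp (-(t / m)) := by
    convert hf using 3
    rw [ht]; field_simp
  refine (norm_pow_sub_exp_neg_le (R := max (Real.exp (-(t / m))) (Real.exp (-(w.re / m))))
    (by omega) hw (hft.trans (le_max_left _ _)) (le_max_right _ _)).trans ?_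
  refine mul_le_mul_of_nonneg_right ?_ (by positivity)
  rcases max_choice (Real.exp (-(t / m))) (Real.exp (-(w.re / m))) with h | h <;> rw [h]
  · exact (exp_neg_div_pow_pred_le hm ht0).trans (le_add_of_nonneg_right (Real.exp_pos _).le)
  · exact (exp_neg_div_pow_pred_le hm hw).trans (le_add_of_nonneg_left (Real.exp_pos _).le)

/-! ### Square integrability for the rows -/

section Row

variable {G : ℕ → Measure ℝ} {b : ℕ → ℝ} {n : ℕ} [IsProbabilityMeasure (G n)]

lemma integrable_norm_charFun_sq {P : Measure ℝ} [IsProbabilityMeasure P] {g : ℝ → ℝ}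
    (hg : IsDensity P g) {D : ENNReal} (hD : D ≠ ⊤)
    (h : ∫⁻ x, ENNReal.ofReal (g x ^ 2) ≤ D) :
    Integrable (fun z => ‖charFun P z‖ ^ 2) ∧
      ∫ z, ‖charFun P z‖ ^ 2 ≤ 2 * Real.pi * D.toReal := by
  have h1 : ∫⁻ z, ENNReal.ofReal (‖charFun P z‖ ^ 2) ≤ ENNReal.ofReal (2 * Real.pi) * D :=
    (lintegral_norm_charFun_sq_le hg).trans (by gcongr)
  have hfin : ENNReal.ofReal (2 * Real.pi) * D ≠ ⊤ := ENNReal.mul_ne_top ENNReal.ofReal_ne_top hD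
  have hnn : 0 ≤ᵐ[volume] fun z => ‖charFun P z‖ ^ 2 :=
    Eventually.of_forall fun z => by positivity
  have hmeas : AEStronglyMeasurable (fun z => ‖charFun P z‖ ^ 2) volume := by fun_prop
  refine ⟨⟨hmeas, ?_⟩, ?_⟩
  · rw [hasFiniteIntegral_iff_ofReal hnn]
    exact h1.trans_lt hfin.lt_top
  · rw [integral_eq_lintegral_of_nonneg_ae hnn hmeas]
    refine (ENNReal.toReal_mono hfin h1).trans_eq ?_
    rw [ENNReal.toReal_mul, ENNReal.toReal_ofReal (by positivity)]

lemma integrable_norm_charFun_lawX_sq {g : ℝ → ℝ} (hb : 0 < b n) (hg : IsDensity (G n) g)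
    {D : ENNReal} (hD : D ≠ ⊤) (h : ∫⁻ x, ENNReal.ofReal (g x ^ 2) ≤ D) :
    Integrable (fun z => ‖charFun (lawX G b n) z‖ ^ 2) ∧
      ∫ z, ‖charFun (lawX G b n) z‖ ^ 2 ≤ b n * (2 * Real.pi * D.toReal) := by
  obtain ⟨h1, h2⟩ := integrable_norm_charFun_sq hg hD h
  simp_rw [charFun_lawX]
  refine ⟨h1.comp_div hb.ne', ?_⟩
  rw [Measure.integral_comp_div (fun z => ‖charFun (G n) z‖ ^ 2), abs_of_pos hb, smul_eq_mul]
  gcongr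

lemma integrable_charFun_lawX_pow {g : ℝ → ℝ} (hb : 0 < b n) (hg : IsDensity (G n) g)
    {D : ENNReal} (hD : D ≠ ⊤) (h : ∫⁻ x, ENNReal.ofReal (g x ^ 2) ≤ D) {m : ℕ} (hm : 2 ≤ m) :
    Integrable fun z => charFun (lawX G b n) z ^ m := by
  have : IsProbabilityMeasure (lawX G b n) := isProbabilityMeasure_lawX
  refine (integrable_norm_charFun_lawX_sq hb hg hD h).1.mono' (by fun_prop)
    (Eventually.of_forall fun z => ?_)
  rw [norm_pow]
  exact pow_le_pow_of_le_one (norm_nonneg _) (norm_charFun_le_one z) hm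

end Row

lemma norm_charFun_le_supN {G : ℕ → Measure ℝ} [∀ n, IsProbabilityMeasure (G n)] {d : ℝ} (n : ℕ)
    {z : ℝ} (hz : d ≤ |z|) : ‖charFun (G n) z‖ ≤ supN G d := by
  refine le_csSup ⟨1, ?_⟩ ⟨n, z, hz, rfl⟩
  rintro _ ⟨k, w, -, rfl⟩
  exact norm_charFun_le_one w

/-- The row lengths grow at most like the squares of the norming constants. -/
lemma exists_eventually_natCast_le_mul_sq {G : ℕ → Measure ℝ} [∀ n, IsProbabilityMeasure (G n)]
    {a : ℕ → ℕ} {b : ℕ → ℝ} (hb_pos : ∀ n, 0 < b n) (hb : Tendsto b atTop atTop) {δ : ℝ}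
    (hδ : 0 < δ) (hC : supN G δ < 1) {w : ℂ}
    (h : Tendsto (fun n => (a n : ℂ) * (1 - charFun (lawX G b n) 1)) atTop (𝓝 w)) :
    ∃ C : ℝ, 0 < C ∧ ∀ᶠ n in atTop, (a n : ℝ) ≤ C * b n ^ 2 := by
  have hre := (Complex.continuous_re.tendsto _).comp h
  refine ⟨(|w.re| + 1) * (δ + 1) ^ 2 / (1 - supN G δ),
    div_pos (by positivity) (by linarith), ?_⟩
  filter_upwards [hre.eventually_le_const (show w.re < |w.re| + 1 by
    linarith [le_abs_self w.re]), hb.eventually_ge_atTop 1] with n hn hb1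
  have : IsProbabilityMeasure (lawX G b n) := isProbabilityMeasure_lawX
  simp only [Function.comp] at hn
  rw [← Complex.ofReal_natCast, Complex.re_ofReal_mul, Complex.sub_re, Complex.one_re] at hn
  -- The smallest integer with `k / b n ≥ δ`. There `Re θ_n ≤ N(δ)`, so `1 - N(δ) ≤ k² (1 - Re θ_n(1
  -- / b_n))`, while `a_n (1 - Re θ_n(1 / b_n))` stays bounded and `k = O(b_n)`.
  set k := ⌈δ * b n⌉₊ with hk
  have hk1 : δ * b n ≤ k := Nat.le_ceil _
  have hk2 : (k : ℝ) ≤ (δ + 1) * b n := by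
    have := Nat.ceil_lt_add_one (mul_pos hδ (hb_pos n)).le
    rw [add_mul, one_mul]
    linarith
  have h1 := one_sub_re_charFun_natCast_mul_le (P := lawX G b n) 1 k
  have h2 : (charFun (lawX G b n) (k * 1)).re ≤ supN G δ := by
    refine (Complex.re_le_norm _).trans ?_
    rw [charFun_lawX]
    refine norm_charFun_le_supN n ?_
    rw [mul_one, abs_of_nonneg (div_nonneg (by positivity) (hb_pos n).le), le_div_iff₀ (hb_pos n)]
    exact hk1
  rw [div_mul_eq_mul_div, le_div_iff₀ (by linarith)]
  have h3 : 0 ≤ 1 - (charFun (lawX G b n) 1).re := by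
    linarith [(Complex.re_le_norm _).trans (norm_charFun_le_one (μ := lawX G b n) 1)]
  calc (a n : ℝ) * (1 - supN G δ) ≤ a n * (k ^ 2 * (1 - (charFun (lawX G b n) 1).re)) := by
        gcongr; linarith
    _ = k ^ 2 * (a n * (1 - (charFun (lawX G b n) 1).re)) := by ring
    _ ≤ ((δ + 1) * b n) ^ 2 * (|w.re| + 1) := by gcongr
    _ = _ := by ring

/-! ### The rate -/

section Rate

variable {G : ℕ → Measure ℝ} {a : ℕ → ℕ} {b : ℕ → ℝ} {β : ℝ} {M : Measure ℝ} {ε δ : ℝ}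

lemma chi_le_rho (n : ℕ) : chi G a b β n ≤ rho G a b β M ε δ n := le_max_left _ _

lemma gammaRe_le_rho (n : ℕ) : gammaRe M (canon G a b n) ≤ rho G a b β M ε δ n :=
  (le_max_left _ _).trans (le_max_right _ _)

lemma gammaIm_le_rho (n : ℕ) : gammaIm M (canon G a b n) ≤ rho G a b β M ε δ n :=
  (le_max_left _ _).trans ((le_max_right _ _).trans (le_max_right _ _))

lemma one_div_le_rho (n : ℕ) : 1 / (a n : ℝ) ≤ rho G a b β M ε δ n :=
  (le_max_left _ _).trans ((le_max_right _ _).trans ((le_max_right _ _).trans (le_max_right _ _)))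

lemma rho_nonneg (n : ℕ) : 0 ≤ rho G a b β M ε δ n :=
  (by positivity : (0 : ℝ) ≤ 1 / (a n : ℝ)).trans (one_div_le_rho n)

variable [∀ n, IsProbabilityMeasure (G n)]

lemma norm_mul_one_sub_charFun_sub_psi_le (hM : IsCanonical M) (n : ℕ) (z : ℝ) :
    ‖(a n : ℂ) * (1 - charFun (lawX G b n) z) - psi β M z‖ ≤
      3 * rho G a b β M ε δ n * (1 + z ^ 2) := by
  rw [mul_one_sub_charFun_lawX]
  refine (norm_psi_canon_sub_le hM β z).trans ?_
  gcongr
  linarith [chi_le_rho (G := G) (a := a) (b := b) (β := β) (M := M) (ε := ε) (δ := δ) n,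
    gammaRe_le_rho (G := G) (a := a) (b := b) (β := β) (M := M) (ε := ε) (δ := δ) n,
    gammaIm_le_rho (G := G) (a := a) (b := b) (β := β) (M := M) (ε := ε) (δ := δ) n]

lemma re_psi_canon_eq (n : ℕ) (z : ℝ) :
    (psi (a n * betaN G b n) (canon G a b n) z).re =
      a n * (1 - (charFun (lawX G b n) z).re) := by
  rw [← mul_one_sub_charFun_lawX, ← Complex.ofReal_natCast, Complex.re_ofReal_mul, Complex.sub_re,
    Complex.one_re]

/-- The freedom `t ≥ Re ψ(z)` allows `t = Re ψ_n(z)` under alternative (b) of Condition F. -/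
lemma exists_exp_neg_re_psi_le (hM : IsCanonical M) {s : ℝ} (hs : 0 < s)
    (hB : ∃ α : ℝ, 0 < α ∧ α < 2 ∧ ∃ c : ℝ, 0 < c ∧ ∃ R : ℝ, ∀ z : ℝ, R ≤ |z| →
      c * |z| ^ α ≤ (psi β M z).re) :
    ∃ K : ℝ, 0 < K ∧ ∀ z t : ℝ, (psi β M z).re ≤ t →
      Real.exp (-(s * t)) ≤ K / (1 + z ^ 2) ^ 3 := by
  obtain ⟨α, hα, -, c, hc, R, hR⟩ := hB
  obtain ⟨K, hK, h⟩ := exists_exp_neg_le_div (mul_pos hs hc) hα R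
  refine ⟨K, hK, fun z t ht => h _ z (mul_nonneg hs.le ?_) fun hz => ?_⟩
  · exact (hM.re_phi_nonneg z).trans ((psi_re β M z).ge.trans ht)
  · rw [mul_assoc]
    exact mul_le_mul_of_nonneg_left ((hR z hz).trans ht) hs.le

/-- Condition F bounds the characteristic functions of the row sums uniformly on `|z| ≤ δ bₙ`. -/
lemma exists_exp_neg_mul_one_sub_re_le (hM : IsCanonical M)
    (hB : ∃ α : ℝ, 0 < α ∧ α < 2 ∧ ∃ c : ℝ, 0 < c ∧ ∃ R : ℝ, ∀ z : ℝ, R ≤ |z| →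
      c * |z| ^ α ≤ (psi β M z).re)
    (hF : ∃ c : ℝ, 0 < c ∧ ∃ κ : ℝ, 0 < κ ∧ κ < 2 ∧ ∀ n,
      (∀ z : ℝ, |z| ≤ δ * b n →
        c * |z| ^ κ ≤ (a n : ℝ) * ∫ u, (1 - Real.cos (z * u)) ∂(symm (lawX G b n))) ∨
      symm M ≤ symm (canon G a b n)) {s : ℝ} (hs : 0 < s) :
    ∃ K : ℝ, 0 < K ∧ ∀ (n : ℕ) (z : ℝ), |z| ≤ δ * b n →
      Real.exp (-(s * (a n * (1 - (charFun (lawX G b n) z).re)))) ≤ K / (1 + z ^ 2) ^ 3 := by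
  obtain ⟨K₁, hK₁, h₁⟩ := exists_exp_neg_re_psi_le (β := β) hM hs hB
  obtain ⟨c, hc, κ, hκ, -, hF⟩ := hF
  obtain ⟨K₂, hK₂, h₂⟩ := exists_exp_neg_le_div (mul_pos hs hc) hκ 0
  refine ⟨K₁ + K₂, by positivity, fun n z hz => ?_⟩
  have hcan : IsCanonical (canon G a b n) := isCanonical_canon
  rw [add_div]
  rcases hF n with h | h
  · refine (h₂ _ z (mul_nonneg hs.le ?_) fun _ => ?_).trans
      (le_add_of_nonneg_left (by positivity))
    · rw [← re_psi_canon_eq, psi_re]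
      exact hcan.re_phi_nonneg z
    · rw [mul_assoc, ← re_psi_canon_eq, ← mul_integral_one_sub_cos_symm]
      exact mul_le_mul_of_nonneg_left (h z hz) hs.le
  · refine (h₁ z _ ?_).trans (le_add_of_nonneg_right (by positivity))
    rw [← re_psi_canon_eq, psi_re, psi_re]
    exact hM.re_phi_mono hcan h z

/-- Converts control of `Re θ_n`, which is all that Condition F offers, into control of `|θ_n|`,
uniformly in `n`. -/
lemma exists_norm_charFun_lawX_le_exp (hb_pos : ∀ n, 0 < b n)
    (hC : supN G (δ / 2) < 1)
    (hG : ∃ m : ℝ, 0 < m ∧ ∀ (n : ℕ) (z : ℝ), |z| ≤ δ → m ≤ |(charFun (G n) z).re|) :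
    ∃ c : ℝ, 0 < c ∧ ∀ (n : ℕ) (z : ℝ), |z| ≤ δ * b n →
      ‖charFun (lawX G b n) z‖ ≤ Real.exp (-(c * (1 - (charFun (lawX G b n) z).re))) := by
  obtain ⟨m, hm, hG⟩ := hG
  refine ⟨(1 + ((min m (1 - supN G (δ / 2)) / 4) ^ 2)⁻¹)⁻¹, by positivity, fun n z hz => ?_⟩
  rw [charFun_lawX]
  refine norm_charFun_le_exp_of_mul_le (mul_one_sub_re_charFun_le (δ := δ) hm hC
    (fun w hw => le_re_charFun_of_le_abs hm (hG n) hw)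
    (fun w hw => norm_charFun_le_supN n hw) ?_)
  rwa [abs_div, abs_of_pos (hb_pos n), div_le_iff₀ (hb_pos n)]

/-- The bound for the difference of the characteristic functions on `|z| ≤ δ bₙ`. -/
theorem exists_norm_charFun_pow_sub_le (ha : Tendsto a atTop atTop) (hb_pos : ∀ n, 0 < b n)
    (hM : IsCanonical M)
    (hB : ∃ α : ℝ, 0 < α ∧ α < 2 ∧ ∃ c : ℝ, 0 < c ∧ ∃ R : ℝ, ∀ z : ℝ, R ≤ |z| →
      c * |z| ^ α ≤ (psi β M z).re)
    (hC : supN G (δ / 2) < 1)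
    (hF : ∃ c : ℝ, 0 < c ∧ ∃ κ : ℝ, 0 < κ ∧ κ < 2 ∧ ∀ n,
      (∀ z : ℝ, |z| ≤ δ * b n →
        c * |z| ^ κ ≤ (a n : ℝ) * ∫ u, (1 - Real.cos (z * u)) ∂(symm (lawX G b n))) ∨
      symm M ≤ symm (canon G a b n))
    (hG : ∃ m : ℝ, 0 < m ∧ ∀ (n : ℕ) (z : ℝ), |z| ≤ δ → m ≤ |(charFun (G n) z).re|) :
    ∃ K : ℝ, 0 < K ∧ ∀ᶠ n in atTop, ∀ z : ℝ, |z| ≤ δ * b n →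
      ‖charFun (lawX G b n) z ^ a n - Complex.exp (-psi β M z)‖ ≤
        K * rho G a b β M ε δ n * (1 + z ^ 2)⁻¹ := by
  obtain ⟨c, hc, hnorm⟩ := exists_norm_charFun_lawX_le_exp hb_pos hC hG
  -- The halves in `c / 2` and `1 / 2` pay for the exponent `a n - 1` in place of `a n`.
  obtain ⟨K₁, hK₁, h₁⟩ := exists_exp_neg_mul_one_sub_re_le (β := β) hM hB hF (half_pos hc)
  obtain ⟨K₂, hK₂, h₂⟩ := exists_exp_neg_re_psi_le (β := β) hM one_half_pos hB
  obtain ⟨K₃, hK₃, h₃⟩ := hM.exists_norm_psi_le β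
  refine ⟨(K₁ + K₂) * (3 + 3 * K₃ ^ 2), by positivity, ?_⟩
  filter_upwards [ha.eventually_ge_atTop 2] with n hn z hz
  have : IsProbabilityMeasure (lawX G b n) := isProbabilityMeasure_lawX
  set ρ := rho G a b β M ε δ n with hρ
  have hρ0 : 0 ≤ ρ := rho_nonneg n
  set f := charFun (lawX G b n) z with hf
  have hf1 : f.re ≤ 1 := (Complex.re_le_norm _).trans (norm_charFun_le_one z)
  have hw : 0 ≤ (psi β M z).re := (hM.re_phi_nonneg z).trans_eq (psi_re β M z).symm
  refine (norm_pow_sub_exp_neg_le_of_norm_le_exp hn hc.le hf1 hw (hnorm n z hz)).trans ?_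
  have e1 : Real.exp (-(c * (a n * (1 - f.re)) / 2)) ≤ K₁ / (1 + z ^ 2) ^ 3 := by
    rw [mul_div_right_comm]
    exact h₁ n z hz
  have e2 : Real.exp (-((psi β M z).re / 2)) ≤ K₂ / (1 + z ^ 2) ^ 3 := by
    rw [div_eq_mul_one_div, mul_comm]
    exact h₂ z _ le_rfl
  have e3 : ‖(a n : ℂ) * (1 - f) - psi β M z‖ ≤ 3 * ρ * (1 + z ^ 2) :=
    norm_mul_one_sub_charFun_sub_psi_le hM n z
  have e4 : 3 * ‖psi β M z‖ ^ 2 / a n ≤ 3 * (K₃ * (1 + z ^ 2)) ^ 2 * ρ := by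
    rw [div_eq_mul_one_div]
    gcongr
    · exact h₃ z
    · exact one_div_le_rho n
  have e5 : 3 * ρ * (1 + z ^ 2) ≤ 3 * ρ * (1 + z ^ 2) ^ 2 := by
    gcongr
    nlinarith [sq_nonneg z]
  calc _ ≤ (K₁ / (1 + z ^ 2) ^ 3 + K₂ / (1 + z ^ 2) ^ 3) *
        (3 * ρ * (1 + z ^ 2) ^ 2 + 3 * (K₃ * (1 + z ^ 2)) ^ 2 * ρ) := by
        gcongr
        exact e3.trans e5
    _ = _ := by
        have : (1 + z ^ 2) ≠ 0 := by positivity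
        field_simp

/-- The bound for the difference of the characteristic functions on `|z| > δ bₙ`. -/
theorem exists_norm_charFun_pow_sub_le_tail (ha : Tendsto a atTop atTop) (hb_pos : ∀ n, 0 < b n)
    (hM : IsCanonical M)
    (hB : ∃ α : ℝ, 0 < α ∧ α < 2 ∧ ∃ c : ℝ, 0 < c ∧ ∃ R : ℝ, ∀ z : ℝ, R ≤ |z| →
      c * |z| ^ α ≤ (psi β M z).re) (hδ : 0 < δ)
    (hab : ∃ C : ℝ, 0 < C ∧ ∀ᶠ n in atTop, (a n : ℝ) ≤ C * b n ^ 2) {q : ℝ}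
    (hq : supN G δ ≤ q) :
    ∃ K : ℝ, 0 < K ∧ ∀ᶠ n in atTop, ∀ z : ℝ, δ * b n < |z| →
      ‖charFun (lawX G b n) z ^ a n - Complex.exp (-psi β M z)‖ ≤
        K * rho G a b β M ε δ n * (1 + z ^ 2)⁻¹ +
          q ^ (a n - 2) * ‖charFun (lawX G b n) z‖ ^ 2 := by
  obtain ⟨K, hK, h⟩ := exists_exp_neg_re_psi_le (β := β) hM one_pos hB
  obtain ⟨C, hC, hab⟩ := hab
  refine ⟨K * C / δ ^ 2, by positivity, ?_⟩
  filter_upwards [ha.eventually_ge_atTop 2, hab] with n hn hn' z hz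
  have hb := hb_pos n
  have ha0 : (0 : ℝ) < a n := by exact_mod_cast (by omega : 0 < a n)
  have hfq : ‖charFun (lawX G b n) z‖ ≤ q := by
    rw [charFun_lawX]
    refine (norm_charFun_le_supN n ?_).trans hq
    rw [abs_div, abs_of_pos hb, le_div_iff₀ hb]
    exact hz.le
  -- Two factors are kept back to be integrated with Condition D; the others are bounded by `q`.
  have e1 : ‖charFun (lawX G b n) z ^ a n‖ ≤
      q ^ (a n - 2) * ‖charFun (lawX G b n) z‖ ^ 2 := by
    rw [norm_pow]
    calc _ = ‖charFun (lawX G b n) z‖ ^ (a n - 2) * ‖charFun (lawX G b n) z‖ ^ 2 := by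
          rw [← pow_add]; congr 1; omega
      _ ≤ _ := by gcongr
  have e2 : ‖Complex.exp (-psi β M z)‖ ≤ K / (1 + z ^ 2) ^ 3 := by
    rw [Complex.norm_exp, Complex.neg_re]
    simpa using h z _ le_rfl
  -- Two of the three powers of decay are traded for the rate, since `z² ≥ δ² b_n² ≥ δ² a_n / C`.
  have e3 : 1 / (1 + z ^ 2) ^ 2 ≤ C / δ ^ 2 * rho G a b β M ε δ n := by
    have hz2 : (δ * b n) ^ 2 ≤ z ^ 2 := by
      rw [← sq_abs z]
      exact pow_le_pow_left₀ (by positivity) hz.le 2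
    calc 1 / (1 + z ^ 2) ^ 2 ≤ 1 / (δ * b n) ^ 2 := by
          gcongr
          nlinarith [sq_nonneg z]
      _ ≤ C / δ ^ 2 * (1 / a n) := by
          rw [div_mul_div_comm, mul_one, div_le_div_iff₀ (by positivity) (by positivity)]
          nlinarith [sq_nonneg δ]
      _ ≤ _ := by
          gcongr
          exact one_div_le_rho n
  refine (norm_sub_le _ _).trans ?_
  rw [add_comm]
  refine add_le_add (e2.trans ?_) e1
  calc K / (1 + z ^ 2) ^ 3 = K * (1 / (1 + z ^ 2) ^ 2) * (1 + z ^ 2)⁻¹ := by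
        field_simp
    _ ≤ K * (C / δ ^ 2 * rho G a b β M ε δ n) * (1 + z ^ 2)⁻¹ := by gcongr
    _ = _ := by ring

/-- The `L¹` distance of the characteristic functions. -/
theorem exists_integral_norm_charFun_pow_sub_le (ha : Tendsto a atTop atTop)
    (hb_pos : ∀ n, 0 < b n) (hM : IsCanonical M)
    (hlim : ∀ z, Tendsto (fun n => (a n : ℂ) * (1 - charFun (lawX G b n) z)) atTop
      (𝓝 (psi β M z)))
    {g : ℕ → ℝ → ℝ} (hA : ∀ n, IsDensity (G n) (g n))
    (hB : ∃ α : ℝ, 0 < α ∧ α < 2 ∧ ∃ c : ℝ, 0 < c ∧ ∃ R : ℝ, ∀ z : ℝ, R ≤ |z| →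
      c * |z| ^ α ≤ (psi β M z).re)
    (hC : ∀ δ' : ℝ, 0 < δ' → supN G δ' < 1)
    (hD : (⨆ n, ∫⁻ x, ENNReal.ofReal (g n x ^ 2)) < (⊤ : ENNReal))
    (hE : Tendsto b atTop atTop) (hE' : Tendsto (fun n => Real.log (b n) / (a n : ℝ)) atTop (𝓝 0))
    (hδ : 0 < δ)
    (hF : ∃ c : ℝ, 0 < c ∧ ∃ κ : ℝ, 0 < κ ∧ κ < 2 ∧ ∀ n,
      (∀ z : ℝ, |z| ≤ δ * b n →
        c * |z| ^ κ ≤ (a n : ℝ) * ∫ u, (1 - Real.cos (z * u)) ∂(symm (lawX G b n))) ∨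
      symm M ≤ symm (canon G a b n))
    (hG : ∃ m : ℝ, 0 < m ∧ ∀ (n : ℕ) (z : ℝ), |z| ≤ δ → m ≤ |(charFun (G n) z).re|) :
    ∃ C : ℝ, 0 < C ∧ ∀ᶠ n in atTop,
      ∫ z, ‖charFun (lawX G b n) z ^ a n - Complex.exp (-psi β M z)‖ ≤
        C * rho G a b β M ε δ n := by
  -- The maximum with `1 / 2` ensures `q > 0`, needed for `log q` and `q⁻²`.
  set q := max (supN G δ) (1 / 2) with hq
  have hq0 : 0 < q := lt_max_of_lt_right one_half_pos
  have hq1 : q < 1 := max_lt (hC δ hδ) one_half_lt_one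
  set D := ⨆ n, ∫⁻ x, ENNReal.ofReal (g n x ^ 2) with hDdef
  have hab := exists_eventually_natCast_le_mul_sq hb_pos hE hδ (hC δ hδ) (hlim 1)
  obtain ⟨K₁, hK₁, h₁⟩ := exists_norm_charFun_pow_sub_le (ε := ε) ha hb_pos hM hB
    (hC (δ / 2) (half_pos hδ)) hF hG
  obtain ⟨K₂, hK₂, h₂⟩ := exists_norm_charFun_pow_sub_le_tail (ε := ε) ha hb_pos hM hB hδ hab
    (le_max_left (supN G δ) (1 / 2))
  refine ⟨(K₁ + K₂) * Real.pi + (q ^ 2)⁻¹ * (2 * Real.pi * D.toReal), by positivity, ?_⟩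
  filter_upwards [h₁, h₂, eventually_mul_pow_le_div ha hb_pos hE' hq0 hq1] with n hn₁ hn₂ hn₃
  obtain ⟨hi, hle⟩ := integrable_norm_charFun_lawX_sq (G := G) (n := n) (hb_pos n) (hA n) hD.ne
    (le_iSup (fun n => ∫⁻ x, ENNReal.ofReal (g n x ^ 2)) n)
  set ρ := rho G a b β M ε δ n with hρ
  have hρ0 : 0 ≤ ρ := rho_nonneg n
  have hpt : ∀ z, ‖charFun (lawX G b n) z ^ a n - Complex.exp (-psi β M z)‖ ≤
      (K₁ + K₂) * ρ * (1 + z ^ 2)⁻¹ + q ^ (a n - 2) * ‖charFun (lawX G b n) z‖ ^ 2 := by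
    intro z
    have hr : (0 : ℝ) ≤ (1 + z ^ 2)⁻¹ := by positivity
    have h1 : 0 ≤ K₁ * ρ * (1 + z ^ 2)⁻¹ := by positivity
    have h2 : 0 ≤ K₂ * ρ * (1 + z ^ 2)⁻¹ := by positivity
    have h3 : 0 ≤ q ^ (a n - 2) * ‖charFun (lawX G b n) z‖ ^ 2 := by positivity
    rw [add_mul, add_mul]
    rcases le_or_gt |z| (δ * b n) with hz | hz
    · linarith [hn₁ z hz]
    · linarith [hn₂ z hz]
  have hi1 : Integrable fun z : ℝ => (K₁ + K₂) * ρ * (1 + z ^ 2)⁻¹ :=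
    integrable_inv_one_add_sq.const_mul _
  have hi2 : Integrable fun z : ℝ => q ^ (a n - 2) * ‖charFun (lawX G b n) z‖ ^ 2 :=
    hi.const_mul _
  calc _ ≤ ∫ z : ℝ, ((K₁ + K₂) * ρ * (1 + z ^ 2)⁻¹ +
        q ^ (a n - 2) * ‖charFun (lawX G b n) z‖ ^ 2) :=
        integral_mono_of_nonneg (Eventually.of_forall fun z => norm_nonneg _) (hi1.add hi2)
          (Eventually.of_forall hpt)
    _ = (K₁ + K₂) * ρ * Real.pi + q ^ (a n - 2) * ∫ z, ‖charFun (lawX G b n) z‖ ^ 2 := by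
        rw [integral_add hi1 hi2, integral_const_mul, integral_const_mul,
          integral_univ_inv_one_add_sq]
    _ ≤ (K₁ + K₂) * ρ * Real.pi + q ^ (a n - 2) * (b n * (2 * Real.pi * D.toReal)) := by gcongr
    _ = (K₁ + K₂) * ρ * Real.pi + (b n * q ^ (a n - 2)) * (2 * Real.pi * D.toReal) := by ring
    _ ≤ (K₁ + K₂) * ρ * Real.pi + ((q ^ 2)⁻¹ / a n) * (2 * Real.pi * D.toReal) := by gcongr
    _ ≤ (K₁ + K₂) * ρ * Real.pi + ((q ^ 2)⁻¹ * ρ) * (2 * Real.pi * D.toReal) := by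
        rw [div_eq_mul_one_div]
        gcongr
        exact one_div_le_rho n
    _ = _ := by ring

end Rate

/-! ### Passage to the limit -/

lemma IsDensity.absolutelyContinuous {m : Measure ℝ} {f : ℝ → ℝ} (h : IsDensity m f) :
    m ≪ volume := by
  rw [h.eq_withDensity]
  exact withDensity_absolutelyContinuous _ _

lemma canon_singleton {G : ℕ → Measure ℝ} {a : ℕ → ℕ} {b : ℕ → ℝ} (hb_pos : ∀ n, 0 < b n)
    (hG : ∀ n, G n ≪ volume) (n : ℕ) (x : ℝ) : canon G a b n {x} = 0 := by
  refine withDensity_absolutelyContinuous _ _ ?_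
  rw [lawX, Measure.map_apply (by fun_prop) (measurableSet_singleton x)]
  refine hG n ?_
  refine Set.Finite.measure_zero (Set.Finite.subset (Set.finite_singleton (x * b n)) ?_) _
  intro y hy
  rw [Set.mem_preimage, Set.mem_singleton_iff, div_eq_iff (hb_pos n).ne'] at hy
  exact hy

lemma tendsto_mul_one_sub_charFun {G : ℕ → Measure ℝ} [∀ n, IsProbabilityMeasure (G n)]
    {a : ℕ → ℕ} {b : ℕ → ℝ} {M : Measure ℝ} {β : ℝ} (hb_pos : ∀ n, 0 < b n)
    (hG : ∀ n, G n ≪ volume) (hM : IsCanonical M) (hMconv : ConvergesProperly (canon G a b) M)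
    (hβconv : Tendsto (fun n => (a n : ℝ) * betaN G b n) atTop (𝓝 β)) (z : ℝ) :
    Tendsto (fun n => (a n : ℂ) * (1 - charFun (lawX G b n) z)) atTop (𝓝 (psi β M z)) := by
  simp_rw [mul_one_sub_charFun_lawX, psi]
  have h := tendsto_phi_of_convergesProperly (fun n => isCanonical_canon)
    (canon_singleton hb_pos hG) hM hMconv z
  have hβ := (Complex.continuous_ofReal.tendsto β).comp hβconv
  exact ((hβ.const_mul (-Complex.I)).mul_const (z : ℂ)).add h

lemma exists_isDensity_of_absolutelyContinuous {P : Measure ℝ} [IsFiniteMeasure P]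
    (h : P ≪ volume) : ∃ f, IsDensity P f := by
  refine ⟨fun x => (P.rnDeriv volume x).toReal, (Measure.measurable_rnDeriv _ _).ennreal_toReal,
    fun x => ENNReal.toReal_nonneg, ?_⟩
  conv_lhs => rw [← Measure.withDensity_rnDeriv_eq _ _ h]
  refine withDensity_congr_ae ?_
  filter_upwards [Measure.rnDeriv_lt_top P volume] with x hx
  rw [ENNReal.ofReal_toReal hx.ne]

end TriangularArray

end

/-! ### Assembly: limit law, densities and rate. -/

open TriangularArray
theorem theorem2
    {Ω : ℕ → Type*} [∀ n, MeasurableSpace (Ω n)]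
    (μ : (n : ℕ) → Measure (Ω n)) [∀ n, IsProbabilityMeasure (μ n)]
    -- the array: in row `n` there are `a n` i.i.d. variables with law `G n`
    (a : ℕ → ℕ) (b : ℕ → ℝ) (ξ : (n : ℕ) → Fin (a n) → Ω n → ℝ) (G : ℕ → Measure ℝ)
    (ha_pos : ∀ n, 0 < a n) (ha : Tendsto a atTop atTop) (hb_pos : ∀ n, 0 < b n)
    (hξ_meas : ∀ n k, Measurable (ξ n k))
    (hξ_law : ∀ n k, (μ n).map (ξ n k) = G n)
    (hξ_indep : ∀ n, iIndepFun (ξ n) (μ n))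
    -- uniform smallness
    (hsmall : ∀ ε : ℝ, 0 < ε → Tendsto (fun n => lawX G b n {x | ε ≤ |x|}) atTop (𝓝 0))
    -- convergence conditions
    (M : Measure ℝ) (β : ℝ) (hM : IsCanonical M)
    (hMconv : ConvergesProperly (canon G a b) M)
    (hβconv : Tendsto (fun n => (a n : ℝ) * betaN G b n) atTop (𝓝 β))
    -- A
    (g : ℕ → ℝ → ℝ) (hA : ∀ n, IsDensity (G n) (g n))
    -- B
    (hB : ∃ α : ℝ, 0 < α ∧ α < 2 ∧ ∃ c : ℝ, 0 < c ∧ ∃ R : ℝ, ∀ z : ℝ, R ≤ |z| →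
      c * |z| ^ α ≤ (psi β M z).re)
    -- C
    (hC : ∀ δ' : ℝ, 0 < δ' → supN G δ' < 1)
    -- D
    (hD : (⨆ n, ∫⁻ x, ENNReal.ofReal (g n x ^ 2)) < (⊤ : ENNReal))
    -- E
    (hE : Tendsto b atTop atTop) (hE' : Tendsto (fun n => Real.log (b n) / (a n : ℝ)) atTop (𝓝 0))
    -- the fixed `δ` of F and G
    (δ : ℝ) (hδ : 0 < δ)
    -- F
    (hF : ∃ c : ℝ, 0 < c ∧ ∃ κ : ℝ, 0 < κ ∧ κ < 2 ∧ ∀ n,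
      (∀ z : ℝ, |z| ≤ δ * b n →
        c * |z| ^ κ ≤ (a n : ℝ) * ∫ u, (1 - Real.cos (z * u)) ∂(symm (lawX G b n))) ∨
      symm M ≤ symm (canon G a b n))
    -- G
    (hG : ∃ m : ℝ, 0 < m ∧ ∀ (n : ℕ) (z : ℝ), |z| ≤ δ → m ≤ |(charFun (G n) z).re|)
    -- the fixed `ε` of the rate
    (ε : ℝ) (hε : 0 < ε) (hε' : ε < 1) :
    -- the infinitely divisible limit law `P` of `Sₙ`
    ∃ (P : Measure ℝ) (_ : IsProbabilityMeasure P),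
      TendstoInDistribution (rowSum ξ b) atTop (id : ℝ → ℝ) μ P ∧
      IsInfinitelyDivisible P ∧
      (∀ z : ℝ, charFun P z = Complex.exp (-psi β M z)) ∧
      -- the densities of `S` and `Sₙ` (continuous versions) and the rate of convergence
      ∃ (p : ℝ → ℝ) (pn : ℕ → ℝ → ℝ),
        IsDensity P p ∧ Continuous p ∧
        (∀ n, IsDensity ((μ n).map (rowSum ξ b n)) (pn n)) ∧
        (∀ᶠ n in atTop, Continuous (pn n)) ∧
        ∃ C : ℝ, 0 < C ∧ ∀ᶠ n in atTop, ∀ x : ℝ, |pn n x - p x| ≤ C * rho G a b β M ε δ n := by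
  have hGprob : ∀ n, IsProbabilityMeasure (G n) := fun n => by
    rw [← hξ_law n ⟨0, ha_pos n⟩]
    exact Measure.isProbabilityMeasure_map (hξ_meas _ _).aemeasurable
  have hGac : ∀ n, G n ≪ volume := fun n => (hA n).absolutelyContinuous
  have hLprob : ∀ n, IsProbabilityMeasure (lawX G b n) := fun n => isProbabilityMeasure_lawX
  have hrow := measurable_rowSum (b := b) hξ_meas
  have hRprob : ∀ n, IsProbabilityMeasure ((μ n).map (rowSum ξ b n)) := fun n =>
    Measure.isProbabilityMeasure_map (hrow n).aemeasurable
  have hchar := charFun_map_rowSum (b := b) hξ_meas hξ_law hξ_indep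
  have hψ := hM.continuous_psi β
  have hre : ∀ z, 0 ≤ (psi β M z).re := fun z =>
    (hM.re_phi_nonneg z).trans_eq (psi_re β M z).symm
  have hlim := tendsto_mul_one_sub_charFun (β := β) hb_pos hGac hM hMconv hβconv
  obtain ⟨P, hP, hPlim⟩ := exists_tendsto_of_tendsto_charFun
    (ν := fun n => ⟨(μ n).map (rowSum ξ b n), hRprob n⟩)
    (f := fun z => Complex.exp (-psi β M z)) (by fun_prop) (fun z => by
      simp only [ProbabilityMeasure.coe_mk, hchar]
      exact tendsto_pow_exp_neg ha (fun n => norm_charFun_le_one z) (hre z) (hlim z))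
  have hint : Integrable (charFun (P : Measure ℝ)) := by
    obtain ⟨K, -, hK⟩ := exists_exp_neg_re_psi_le (β := β) hM one_pos hB
    refine (integrable_inv_one_add_sq.const_mul K).mono' (by fun_prop)
      (Eventually.of_forall fun z => ?_)
    rw [hP, Complex.norm_exp, Complex.neg_re]
    refine (show _ ≤ K / (1 + z ^ 2) ^ 3 by simpa using hK z _ le_rfl).trans ?_
    rw [div_eq_mul_inv]
    have hK0 : 0 ≤ K := by
      have := (Real.exp_pos _).le.trans (hK 0 _ le_rfl)
      simpa using this
    gcongr
    nlinarith [sq_nonneg z, pow_le_pow_right₀ (show 1 ≤ 1 + z ^ 2 by nlinarith [sq_nonneg z])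
      (show 1 ≤ 3 by norm_num)]
  have hD' : ∀ n, ∫⁻ x, ENNReal.ofReal (g n x ^ 2) ≤ ⨆ n, ∫⁻ x, ENNReal.ofReal (g n x ^ 2) :=
    le_iSup (fun n => ∫⁻ x, ENNReal.ofReal (g n x ^ 2))
  have hintn : ∀ n, 2 ≤ a n → Integrable (charFun ((μ n).map (rowSum ξ b n))) := by
    intro n hn
    rw [funext (hchar n)]
    exact integrable_charFun_lawX_pow (hb_pos n) (hA n) hD.ne (hD' n) hn
  have hdens : ∀ n, ∃ f, IsDensity ((μ n).map (rowSum ξ b n)) f ∧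
      (2 ≤ a n → f = invDensity (charFun ((μ n).map (rowSum ξ b n)))) := by
    intro n
    -- With two summands the characteristic function is dominated by an integrable square, so
    -- inversion gives a continuous density. The finitely many rows of length one take any density.
    rcases le_or_gt 2 (a n) with hn | hn
    · exact ⟨_, isDensity_invDensity (hintn n hn), fun _ => rfl⟩
    · obtain ⟨f, hf⟩ := exists_isDensity_of_absolutelyContinuous
        (map_rowSum_absolutelyContinuous ha_pos hb_pos hξ_meas hξ_law hξ_indep n (hGac n))
      exact ⟨f, hf, fun h => absurd h (not_le.2 hn)⟩
  choose pn hpn hpn' using hdens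
  obtain ⟨C, hC0, hCle⟩ := exists_integral_norm_charFun_pow_sub_le (ε := ε) ha hb_pos hM hlim hA hB
    hC hD hE hE' hδ hF hG
  refine ⟨P, inferInstance, ⟨fun n => (hrow n).aemeasurable, aemeasurable_id, ?_⟩,
    isInfinitelyDivisible_of_charFun hP fun k hk =>
      exists_charFun_eq_exp_neg_div ha hψ hre hlim hk, hP,
    invDensity (charFun (P : Measure ℝ)), pn, isDensity_invDensity hint,
    continuous_invDensity hint, hpn, ?_, C, hC0, ?_⟩
  -- Convergence in distribution refers to the law of `id` under `P`, which is `P`.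
  · have hid : (⟨(P : Measure ℝ).map id, Measure.isProbabilityMeasure_map aemeasurable_id⟩ :
        ProbabilityMeasure ℝ) = P := Subtype.ext Measure.map_id
    rw [hid]
    exact hPlim
  · filter_upwards [ha.eventually_ge_atTop 2] with n hn
    rw [hpn' n hn]
    exact continuous_invDensity (hintn n hn)
  · filter_upwards [ha.eventually_ge_atTop 2, hCle] with n hn hle x
    rw [hpn' n hn]
    refine (abs_invDensity_sub_le (hintn n hn) hint x).trans ?_
    simpa only [hchar, hP] using hle
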